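/- Let $n\ge 2$, let $f\in C^1(\mathbb R)$, and let $u\in W^{3,1}_{\mathrm{loc}}(\mathbb R^n)$ be a radial (that is, $u(x)=g(|x|)$ for almost every $x$, for some function $g$) stable solution of $$\operatorname{div}\Bigl(\frac{\nabla u}{\sqrt{1+|\nabla u|^2}}\Bigr)=-f(u)\qquad\text{in }\mathbb R^n .$$ Here $\nabla u$ is the weak gradient, and "stable solution" means that $f(u)$ and $f'(u)$ belong to $L^1_{\mathrm{loc}}(\mathbb R^n)$, that $$\int_{\mathbb R^n}\frac{\nabla u\cdot\nabla\varphi}{\sqrt{1+|\nabla u|^2}}\,dx=\int_{\mathbb R^n}f(u)\,\varphi\,dx\qquad\text{for all }\varphi\in C_c^\infty(\mathbb R^n),$$ and that $$\int_{\mathbb R^n}f'(u)\,\xi^2\,dx\le\int_{\mathbb R^n}\Bigl(\frac{|\nabla\xi|^2}{\sqrt{1+|\nabla u|^2}}-\frac{(\nabla u\cdot\nabla\xi)^2}{(1+|\nabla u|^2)^{3/2}}\Bigr)dx\qquad\text{for all }\xi\in C_c^\infty(\mathbb R^n).$$ Let $B_r$ denote the ball of radius $r$ centred at the origin. Functions are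 identified when they agree almost everywhere; accordingly the growth conditions below are understood for almost every $x$. (1) If $u$ is nonconstant, then there are $c>0$ and $R_0>2$ such that $$\frac{1}{|B_{2R}\setminus B_R|}\int_{B_{2R}\setminus B_R}\frac{|\nabla u|^2}{(1+|\nabla u|^2)^{3/2}}\,dx\ \ge\ c\,R^{-n+2\sqrt{n-1}+2}\qquad\text{for all }R\ge R_0 .$$ (2) In particular, $u$ is constant if one of the following conditions holds: - $2\le n\le 6$; - $n\ge 7$ and $|\nabla u(x)|=o\bigl(|x|^{-n/2+\sqrt{n-1}+1}\bigr)$ as $|x|\to+\infty$; - $n\ge 7$ and $|\nabla u(x)|^{-1}=o\bigl(|x|^{-n+2\sqrt{n-1}+2}\bigr)$ as $|x|\to+\infty$ (in particular $\nabla u(x)\ne 0$ for $|x|$ large). -/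

import Mathlib

open MeasureTheory
open scoped ContDiff

noncomputable section

namespace StableMeanCurvature

/-- Test functions of class `C_c^∞(ℝⁿ)`. -/
def IsTestFunction {n : ℕ} (φ : EuclideanSpace ℝ (Fin n) → ℝ) : Prop :=
  ContDiff ℝ ∞ φ ∧ HasCompactSupport φ

/-- `v` is the `i`-th weak partial derivative of `u` on `ℝⁿ`
(both functions are required to be locally integrable where this is used). -/
def IsWeakPartial {n : ℕ} (i : Fin n) (u v : EuclideanSpace ℝ (Fin n) → ℝ) : Prop :=
  ∀ φ : EuclideanSpace ℝ (Fin n) → ℝ, IsTestFunction φ →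
    ∫ x, u x * fderiv ℝ φ x (EuclideanSpace.single i 1) = -∫ x, v x * φ x

/-- The local Sobolev space `W^{k,1}_loc(ℝⁿ)`: locally integrable functions whose weak partial
derivatives of order at most `k` exist and are locally integrable. -/
def MemSobolevLoc {n : ℕ} : ℕ → (EuclideanSpace ℝ (Fin n) → ℝ) → Prop
  | 0, u => LocallyIntegrable u volume
  | k + 1, u => LocallyIntegrable u volume ∧
      ∀ i : Fin n, ∃ v : EuclideanSpace ℝ (Fin n) → ℝ, IsWeakPartial i u v ∧ MemSobolevLoc k v

/-- The vector field `G` is a weak gradient `∇u` of the function `u ∈ W^{1,1}_loc(ℝⁿ)`.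
It is determined by `u` up to a null set. -/
structure IsWeakGradient {n : ℕ} (u : EuclideanSpace ℝ (Fin n) → ℝ)
    (G : EuclideanSpace ℝ (Fin n) → EuclideanSpace ℝ (Fin n)) : Prop where
  locallyIntegrable : LocallyIntegrable u volume
  locallyIntegrable_grad : LocallyIntegrable G volume
  weakPartial : ∀ i : Fin n, IsWeakPartial i u (fun x => G x i)

/-- `u`, with weak gradient `G`, is a weak solution on `ℝⁿ` of
`div (∇u / √(1 + |∇u|²)) = -f(u)`. -/
structure IsWeakSolution {n : ℕ} (f : ℝ → ℝ) (u : EuclideanSpace ℝ (Fin n) → ℝ)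
    (G : EuclideanSpace ℝ (Fin n) → EuclideanSpace ℝ (Fin n)) : Prop where
  weakGradient : IsWeakGradient u G
  locallyIntegrable_f : LocallyIntegrable (fun x => f (u x)) volume
  equation : ∀ φ : EuclideanSpace ℝ (Fin n) → ℝ, IsTestFunction φ →
    ∫ x, inner ℝ (G x) (gradient φ x) / √(1 + ‖G x‖ ^ 2) = ∫ x, f (u x) * φ x

/-- `u`, with weak gradient `G`, is a stable solution on `ℝⁿ` of
`div (∇u / √(1 + |∇u|²)) = -f(u)`. -/
structure IsStableSolution {n : ℕ} (f : ℝ → ℝ) (u : EuclideanSpace ℝ (Fin n) → ℝ)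
    (G : EuclideanSpace ℝ (Fin n) → EuclideanSpace ℝ (Fin n)) : Prop where
  weakSolution : IsWeakSolution f u G
  locallyIntegrable_deriv : LocallyIntegrable (fun x => deriv f (u x)) volume
  stable : ∀ ξ : EuclideanSpace ℝ (Fin n) → ℝ, IsTestFunction ξ →
    ∫ x, deriv f (u x) * ξ x ^ 2 ≤
      ∫ x, (‖gradient ξ x‖ ^ 2 / √(1 + ‖G x‖ ^ 2)
        - inner ℝ (G x) (gradient ξ x) ^ 2 / (1 + ‖G x‖ ^ 2) ^ (3 / 2 : ℝ))

/-- `u` is (almost everywhere equal to) a radial function about the origin. -/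
def IsRadial {n : ℕ} (u : EuclideanSpace ℝ (Fin n) → ℝ) : Prop :=
  ∃ g : ℝ → ℝ, ∀ᵐ x, u x = g ‖x‖

/-- `u` is (almost everywhere equal to) a constant. -/
def IsConstant {n : ℕ} (u : EuclideanSpace ℝ (Fin n) → ℝ) : Prop :=
  ∃ c : ℝ, ∀ᵐ x, u x = c

/-- `|G(x)| = o(|x|^q)` as `|x| → ∞`, for a field `G` defined almost everywhere. -/
def NormIsLittleO {n : ℕ} (G : EuclideanSpace ℝ (Fin n) → EuclideanSpace ℝ (Fin n))
    (q : ℝ) : Prop :=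
  ∀ ε : ℝ, 0 < ε → ∃ M : ℝ, ∀ᵐ x, M < ‖x‖ → ‖G x‖ ≤ ε * ‖x‖ ^ q

/-- `|G(x)|⁻¹ = o(|x|^q)` as `|x| → ∞`, for a field `G` defined almost everywhere; in particular
`G(x) ≠ 0` for almost every `x` with `|x|` large. -/
def InvNormIsLittleO {n : ℕ} (G : EuclideanSpace ℝ (Fin n) → EuclideanSpace ℝ (Fin n))
    (q : ℝ) : Prop :=
  ∀ ε : ℝ, 0 < ε → ∃ M : ℝ, ∀ᵐ x, M < ‖x‖ → G x ≠ 0 ∧ ‖G x‖⁻¹ ≤ ε * ‖x‖ ^ q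

end StableMeanCurvature

end

noncomputable section

namespace StableMeanCurvature

open Set Filter Topology

/-! Write u(x) = g(|x|), p = g', N = n - 1, S = √(1 + p²). The radial equation reads (r^N p/S)' =
-r^N f(g), and dividing by r^N and differentiating once more gives a linear equation for p, namely
(p/S)'' = -f'(g) p - N ((p/S)/r)'. Multiplying it by r^N p η² and integrating by parts shows that ∫
r^N (N (p²/S) η²/r² - (p²/S³) η'²) equals ∫ r^N f'(g) (pη)² - ∫ r^N ((pη)')²/S³, and the latter is ≤
0 by stability tested with pη. Since 1/S ≥ 1/S³, the bounded weight ψ = p²/S³ = |∇u|²/(1 +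
|∇u|²)^(3/2) satisfies a Hardy inequality in the direction opposite to the usual one: ∫ r^N ψ (N
η²/r² - η'²) ≤ 0 (`hardy_of_radial_stable`).

Such a weight has to be large at infinity. Put s = √N. For a power η = r^a with |a| < s the
integrand is positive, so positive mass of ψ somewhere must be paid for where η is cut off. Take η
behaving like r^(1/2) at 0 and like r^(-s) at infinity. Because ψ ≤ 1, the cutoff at the origin
costs arbitrarily little; the cutoff on [R, 2R] costs at most a constant times R^(-2s-2) ∫ r^N ψ
over [R, 2R]. Hence that integral is at least c R^(2s+2) as soon as ψ is positive at one point, that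
is, as soon as u is nonconstant (`exists_growth_of_hardy`). Dividing by the volume of the annulus,
of order R^n, gives (1).

For (2), the exponent e = -n + 2√(n-1) + 2 is positive exactly when n² - 8n + 8 < 0, which for
integers n ≥ 2 means n ≤ 6; growth then contradicts ψ ≤ 1. For n ≥ 7 the growth conditions
contradict (1) through ψ ≤ |∇u|² and ψ ≤ 1/|∇u|.

The remaining work is regularity. Spherical means of u, x·∇u and the second derivatives contracted
with x satisfy one-dimensional weak differential relations, which give a C¹ profile g on (0, ∞)
(`exists_radial_profile`). The equation then makes the flux C¹, hence p is C¹ and (p/S)' is C¹ as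
well. All tests are supported away from the origin, so no behaviour of g at 0 is needed. -/

/-- Functions of class `C^k` on the line whose support is a compact subset of `(0, ∞)`. -/
structure IsHalfLineTest (k : WithTop ℕ∞) (φ : ℝ → ℝ) : Prop where
  contDiff : ContDiff ℝ k φ
  exists_Icc : ∃ a b, 0 < a ∧ a ≤ b ∧ ∀ x, x ∉ Icc a b → φ x = 0

/-! ### Test functions on the half-line. -/

theorem deriv_eq_zero_of_notMem_Icc {φ : ℝ → ℝ} {a b : ℝ} (h : ∀ x, x ∉ Icc a b → φ x = 0)
    {x : ℝ} (hx : x ∉ Icc a b) : deriv φ x = 0 := by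
  have : φ =ᶠ[𝓝 x] fun _ => 0 := by
    filter_upwards [isClosed_Icc.isOpen_compl.mem_nhds hx] with y hy using h y hy
  rw [this.deriv_eq, deriv_const]

theorem hasCompactSupport_of_Icc {φ : ℝ → ℝ} {a b : ℝ} (h : ∀ x, x ∉ Icc a b → φ x = 0) :
    HasCompactSupport φ :=
  HasCompactSupport.intro isCompact_Icc (fun x hx => h x hx)

theorem integrable_mul_of_Icc {h φ : ℝ → ℝ} (hh : LocallyIntegrableOn h (Ioi 0)) {a b : ℝ}
    (ha : 0 < a) (hφ : ContinuousOn φ (Icc a b)) (h0 : ∀ x, x ∉ Icc a b → φ x = 0) :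
    Integrable (fun x => h x * φ x) := by
  have hs : Icc a b ⊆ Ioi (0 : ℝ) := fun x hx => lt_of_lt_of_le ha hx.1
  have h1 : IntegrableOn h (Icc a b) := hh.integrableOn_compact_subset hs isCompact_Icc
  have h2 : IntegrableOn (fun x => h x * φ x) (Icc a b) := h1.mul_continuousOn hφ isCompact_Icc
  refine (integrableOn_iff_integrable_of_support_subset fun x hx => ?_).mp h2
  by_contra hx'
  exact hx (by simp [h0 x hx'])

theorem integral_eq_intervalIntegral_of_Icc {F : ℝ → ℝ} {a b : ℝ} (hab : a ≤ b)
    (h0 : ∀ x, x ∉ Icc a b → F x = 0) : ∫ x, F x = ∫ x in a..b, F x := by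
  rw [intervalIntegral.integral_of_le hab, ← integral_Icc_eq_integral_Ioc,
    setIntegral_eq_integral_of_forall_compl_eq_zero h0]

theorem IsHalfLineTest.integrable_mul {k : WithTop ℕ∞} {h φ : ℝ → ℝ}
    (hh : LocallyIntegrableOn h (Ioi 0)) (hφ : IsHalfLineTest k φ) :
    Integrable (fun x => h x * φ x) := by
  obtain ⟨a, b, ha, _, h0⟩ := hφ.exists_Icc
  exact integrable_mul_of_Icc hh ha hφ.contDiff.continuous.continuousOn h0

theorem IsHalfLineTest.integrable_mul_deriv {k : WithTop ℕ∞} (hk : k ≠ 0) {h φ : ℝ → ℝ}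
    (hh : LocallyIntegrableOn h (Ioi 0)) (hφ : IsHalfLineTest k φ) :
    Integrable (fun x => h x * deriv φ x) := by
  obtain ⟨a, b, ha, _, h0⟩ := hφ.exists_Icc
  exact integrable_mul_of_Icc hh ha
    (hφ.contDiff.continuous_deriv (ENat.one_le_iff_ne_zero_withTop.mpr hk)).continuousOn
    fun x hx => deriv_eq_zero_of_notMem_Icc h0 hx

theorem isHalfLineTest_of_tsupport {k : WithTop ℕ∞} {φ : ℝ → ℝ} (h : ContDiff ℝ k φ)
    (hc : HasCompactSupport φ) (hs : tsupport φ ⊆ Ioi 0) : IsHalfLineTest k φ := by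
  refine ⟨h, ?_⟩
  rcases (tsupport φ).eq_empty_or_nonempty with he | hne
  · exact ⟨1, 1, one_pos, le_rfl, fun x _ => image_eq_zero_of_notMem_tsupport (by simp [he])⟩
  · obtain ⟨m, hm, hmin⟩ := hc.isCompact.exists_isMinOn hne continuousOn_id
    obtain ⟨M, hM, hmax⟩ := hc.isCompact.exists_isMaxOn hne continuousOn_id
    exact ⟨m, M, hs hm, hmin hM, fun x hx => image_eq_zero_of_notMem_tsupport
      fun hx' => hx ⟨hmin hx', hmax hx'⟩⟩

/-! ### Weak derivatives on the half-line. -/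

/-- A locally integrable function on `(0, ∞)` with vanishing weak derivative is constant. -/
theorem ae_eq_const_of_integral_mul_deriv_eq_zero {Q : ℝ → ℝ}
    (hQ : LocallyIntegrableOn Q (Ioi 0))
    (h : ∀ φ, IsHalfLineTest ∞ φ → ∫ x, Q x * deriv φ x = 0) :
    ∃ c, ∀ᵐ x, x ∈ Ioi (0 : ℝ) → Q x = c := by
  let β : ContDiffBump (1 : ℝ) := ⟨1 / 4, 1 / 2, by norm_num, by norm_num⟩
  set φ₀ : ℝ → ℝ := β.normed volume with hφ₀
  have hφ₀i : ∫ x, φ₀ x = 1 := β.integral_normed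
  have hφ₀s : ∀ x, x ∉ Icc (1 / 2 : ℝ) (3 / 2) → φ₀ x = 0 := by
    intro x hx
    by_contra hne
    have : x ∈ Function.support φ₀ := hne
    rw [hφ₀, β.support_normed_eq, Real.ball_eq_Ioo] at this
    apply hx
    simp only [β, mem_Ioo] at this
    constructor <;> linarith [this.1, this.2]
  have hφ₀t : IsHalfLineTest ∞ φ₀ :=
    ⟨β.contDiff_normed, 1 / 2, 3 / 2, by norm_num, by norm_num, hφ₀s⟩
  set c := ∫ x, Q x * φ₀ x with hc
  refine ⟨c, ?_⟩
  have key : ∀ᵐ x, x ∈ Ioi (0 : ℝ) → Q x - c = 0 := by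
    refine isOpen_Ioi.ae_eq_zero_of_integral_contDiff_smul_eq_zero
      (hQ.sub (continuousOn_const.locallyIntegrableOn measurableSet_Ioi)) ?_
    intro ψ hψ hψc hψs
    have hψt := isHalfLineTest_of_tsupport hψ hψc hψs
    obtain ⟨a', b', ha', hab', h0'⟩ := hψt.exists_Icc
    set m := ∫ x, ψ x with hm
    -- The bump `φ₀` has integral one, so `ρ` has integral zero and its primitive has compact
    -- support. Being a legitimate test function, that primitive gives ∫ Qρ = 0, which is the claim
    -- with c = ∫ Qφ₀.
    set ρ : ℝ → ℝ := fun x => ψ x - m * φ₀ x with hρ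
    have hρc : ContDiff ℝ ∞ ρ := hψ.sub (contDiff_const.mul β.contDiff_normed)
    set a := min a' (1 / 2)
    set b := max b' (3 / 2)
    have ha : 0 < a := lt_min ha' (by norm_num)
    have hab : a ≤ b := (min_le_left _ _).trans (hab'.trans (le_max_left _ _))
    have hρ0 : ∀ x, x ∉ Icc a b → ρ x = 0 := by
      intro x hx
      have h1 : x ∉ Icc a' b' := fun h =>
        hx ⟨(min_le_left _ _).trans h.1, h.2.trans (le_max_left _ _)⟩
      have h2 : x ∉ Icc (1 / 2 : ℝ) (3 / 2) := fun h =>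
        hx ⟨(min_le_right _ _).trans h.1, h.2.trans (le_max_right _ _)⟩
      simp [hρ, h0' x h1, hφ₀s x h2]
    have hψi : Integrable ψ := hψ.continuous.integrable_of_hasCompactSupport hψc
    have hφ₀int : Integrable φ₀ := β.integrable_normed
    have hρi : ∫ x, ρ x = 0 := by
      rw [hρ, integral_sub hψi (hφ₀int.const_mul m), integral_const_mul, hφ₀i]
      simp [hm]
    set Φ : ℝ → ℝ := fun x => ∫ t in a..x, ρ t with hΦ
    have hΦd : ∀ x, HasDerivAt Φ (ρ x) x := fun x =>
      intervalIntegral.integral_hasDerivAt_right (hρc.continuous.intervalIntegrable _ _)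
        hρc.continuous.stronglyMeasurable.stronglyMeasurableAtFilter hρc.continuous.continuousAt
    have hΦd' : deriv Φ = ρ := funext fun x => (hΦd x).deriv
    have hΦt : IsHalfLineTest ∞ Φ := by
      refine ⟨contDiff_infty_iff_deriv.mpr ⟨fun x => (hΦd x).differentiableAt, hΦd' ▸ hρc⟩,
        a, b, ha, hab, fun x hx => ?_⟩
      rcases lt_or_ge x a with hxa | hxa
      · rw [hΦ]
        simp only
        rw [intervalIntegral.integral_symm, neg_eq_zero]
        rw [intervalIntegral.integral_of_le hxa.le, integral_Ioc_eq_integral_Ioo]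
        refine setIntegral_eq_zero_of_forall_eq_zero fun y hy => hρ0 y fun hy' => ?_
        exact absurd hy.2 (not_lt.mpr hy'.1)
      · have hxb : b < x := by
          by_contra hxb
          exact hx ⟨hxa, not_lt.mp hxb⟩
        rw [← hρi, hΦ]
        simp only
        rw [integral_eq_intervalIntegral_of_Icc (a := a) (b := x) hxa]
        intro y hy
        exact hρ0 y fun hy' => hy ⟨hy'.1, hy'.2.trans hxb.le⟩
    have h1 := h Φ hΦt
    rw [hΦd'] at h1
    have hQψ : Integrable fun x => Q x * ψ x := hψt.integrable_mul hQ
    have hQφ : Integrable fun x => Q x * φ₀ x := hφ₀t.integrable_mul hQ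
    have h2 : ∫ x, Q x * ρ x = (∫ x, Q x * ψ x) - m * ∫ x, Q x * φ₀ x := by
      rw [← integral_const_mul, ← integral_sub hQψ (hQφ.const_mul m)]
      congr 1; ext x; simp only [hρ]; ring
    have h3 : ∫ x, ψ x • (Q x - c) = (∫ x, Q x * ψ x) - c * m := by
      rw [hm, ← integral_const_mul, ← integral_sub hQψ (hψi.const_mul c)]
      congr 1; ext x; simp only [smul_eq_mul]; ring
    rw [h3]
    rw [h2] at h1
    linarith
  filter_upwards [key] with x hx h0 using sub_eq_zero.mp (hx h0)

/-- A locally integrable function on `(0, ∞)` with a locally integrable weak derivative `H` is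
almost everywhere a primitive of `H`. -/
theorem ae_eq_primitive_of_weakDeriv {P H : ℝ → ℝ} (hP : LocallyIntegrableOn P (Ioi 0))
    (hH : LocallyIntegrableOn H (Ioi 0))
    (h : ∀ φ, IsHalfLineTest ∞ φ → ∫ x, P x * deriv φ x = -∫ x, H x * φ x) :
    ContinuousOn (fun x => ∫ t in (1 : ℝ)..x, H t) (Ioi 0) ∧
    ∃ c, ∀ᵐ x, x ∈ Ioi (0 : ℝ) → P x = c + ∫ t in (1 : ℝ)..x, H t := by
  have hint : ∀ a b : ℝ, 0 < a → 0 < b → IntervalIntegrable H volume a b := by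
    intro a b ha hb
    refine (hH.integrableOn_compact_subset (fun x hx => ?_) isCompact_uIcc).intervalIntegrable
    exact lt_of_lt_of_le (lt_min ha hb) hx.1
  have hac : ∀ a b : ℝ, 0 < a → a ≤ 1 → 1 ≤ b →
      AbsolutelyContinuousOnInterval (fun x => ∫ t in (1 : ℝ)..x, H t) a b := by
    intro a b ha ha1 hb
    exact (hint a b ha (by linarith)).absolutelyContinuousOnInterval_intervalIntegral
      (by rw [uIcc_of_le (by linarith)]; exact ⟨ha1, hb⟩)
  have hcont : ContinuousOn (fun x => ∫ t in (1 : ℝ)..x, H t) (Ioi 0) := by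
    intro x hx
    have hx : 0 < x := hx
    have h1 := (hac (min (x / 2) 1) (max (x + 1) 1) (lt_min (by linarith) one_pos)
      (min_le_right _ _) (le_max_right _ _)).continuousOn
    refine (h1.continuousAt ?_).continuousWithinAt
    rw [uIcc_of_le ((min_le_right _ _).trans (le_max_right _ _))]
    exact Icc_mem_nhds ((min_le_left _ _).trans_lt (by linarith))
      (lt_of_lt_of_le (by linarith) (le_max_left _ _))
  refine ⟨hcont, ?_⟩
  have hQ : LocallyIntegrableOn (fun x => P x - ∫ t in (1 : ℝ)..x, H t) (Ioi 0) :=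
    hP.sub (hcont.locallyIntegrableOn measurableSet_Ioi)
  obtain ⟨c, hc⟩ := ae_eq_const_of_integral_mul_deriv_eq_zero hQ (fun φ hφ => by
    obtain ⟨a', b', ha', hab', h0'⟩ := hφ.exists_Icc
    -- The support interval is enlarged strictly, so that `φ` vanishes at both endpoints, and made
    -- to contain the base point 1 of the primitive.
    set a := min (a' / 2) 1
    set b := max (b' + 1) 1
    have ha : 0 < a := lt_min (by linarith) one_pos
    have hab : a ≤ b := (min_le_right _ _).trans (le_max_right _ _)
    have haa' : a < a' := (min_le_left _ _).trans_lt (by linarith)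
    have hbb' : b' < b := lt_of_lt_of_le (by linarith) (le_max_left _ _)
    have h0 : ∀ x, x ∉ Icc a b → φ x = 0 := fun x hx =>
      h0' x fun hx' => hx ⟨haa'.le.trans hx'.1, hx'.2.trans hbb'.le⟩
    have hφa : φ a = 0 := h0' a fun hx' => absurd hx'.1 (not_le.mpr haa')
    have hφb : φ b = 0 := h0' b fun hx' => absurd hx'.2 (not_le.mpr hbb')
    have hφd : Continuous (deriv φ) := hφ.contDiff.continuous_deriv (by simp)
    have hφac : AbsolutelyContinuousOnInterval φ a b := by
      have h1 : AbsolutelyContinuousOnInterval (fun x => ∫ t in a..x, deriv φ t) a b :=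
        (hφd.intervalIntegrable a b).absolutelyContinuousOnInterval_intervalIntegral (by simp)
      convert h1 using 2 with x
      rw [intervalIntegral.integral_deriv_eq_sub
        (fun y _ => (hφ.contDiff.differentiable (by simp)).differentiableAt)
        (hφd.intervalIntegrable a _), hφa, sub_zero]
    have hparts := (hac a b ha (min_le_right _ _) (le_max_right _ _)).integral_mul_deriv_eq_deriv_mul
      hφac
    rw [hφa, hφb] at hparts
    have hderiv : ∫ x in a..b, deriv (fun x => ∫ t in (1 : ℝ)..x, H t) x * φ x
        = ∫ x in a..b, H x * φ x := by
      apply intervalIntegral.integral_congr_ae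
      filter_upwards [(hint a b ha (by linarith)).ae_hasDerivAt_integral] with x hx hx'
      rw [(hx (uIoc_subset_uIcc hx') 1 (by
        rw [uIcc_of_le hab]; exact ⟨min_le_right _ _, le_max_right _ _⟩)).deriv]
    have e1 : ∫ x, H x * φ x = ∫ x in a..b, H x * φ x :=
      integral_eq_intervalIntegral_of_Icc hab fun x hx => by simp [h0 x hx]
    have e2 : ∫ x, (∫ t in (1 : ℝ)..x, H t) * deriv φ x
        = ∫ x in a..b, (∫ t in (1 : ℝ)..x, H t) * deriv φ x :=
      integral_eq_intervalIntegral_of_Icc hab fun x hx => by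
        simp [deriv_eq_zero_of_notMem_Icc h0 hx]
    have h1 := h φ hφ
    have i1 : Integrable fun x => P x * deriv φ x := hφ.integrable_mul_deriv (by simp) hP
    have i2 : Integrable fun x => (∫ t in (1 : ℝ)..x, H t) * deriv φ x :=
      hφ.integrable_mul_deriv (by simp) (hcont.locallyIntegrableOn measurableSet_Ioi)
    simp_rw [sub_mul]
    rw [integral_sub i1 i2, h1, e1, e2, hparts, hderiv]
    ring)
  refine ⟨c, ?_⟩
  filter_upwards [hc] with x hx h0
  linarith [hx h0]

/-! ### Building C¹ test functions from functions regular only on (0, ∞). -/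

theorem hasDerivAt_primitive_of_continuousOn {H : ℝ → ℝ} (hH : ContinuousOn H (Ioi 0)) {x : ℝ}
    (hx : 0 < x) (c : ℝ) : HasDerivAt (fun x => c + ∫ t in (1 : ℝ)..x, H t) (H x) x := by
  refine HasDerivAt.const_add c ?_
  have hs : uIcc 1 x ⊆ Ioi (0 : ℝ) := fun y hy => lt_of_lt_of_le (lt_min one_pos hx) hy.1
  exact intervalIntegral.integral_hasDerivAt_right (hH.mono hs).intervalIntegrable
    (hH.stronglyMeasurableAtFilter isOpen_Ioi x hx) (hH.continuousAt (Ioi_mem_nhds hx))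

theorem continuous_of_continuousOn_Ioi {F : ℝ → ℝ} (hF : ContinuousOn F (Ioi 0)) {a b : ℝ}
    (ha : 0 < a) (h0 : ∀ x, x ∉ Icc a b → F x = 0) : Continuous F := by
  rw [continuous_iff_continuousAt]
  intro x
  rcases lt_or_ge 0 x with hx | hx
  · exact hF.continuousAt (Ioi_mem_nhds hx)
  · have : F =ᶠ[𝓝 x] fun _ => 0 := by
      filter_upwards [Iio_mem_nhds (lt_of_le_of_lt hx ha)] with y hy
      exact h0 y fun hy' => absurd hy'.1 (not_le.mpr hy)
    exact (continuousAt_congr this).mpr continuousAt_const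

theorem hasDerivAt_of_Ioi {F F' : ℝ → ℝ} (hF : ∀ x, 0 < x → HasDerivAt F (F' x) x) {a b : ℝ}
    (ha : 0 < a) (h0 : ∀ x, x ∉ Icc a b → F x = 0) (h0' : ∀ x, x ∉ Icc a b → F' x = 0) (x : ℝ) :
    HasDerivAt F (F' x) x := by
  rcases lt_or_ge 0 x with hx | hx
  · exact hF x hx
  · have : F =ᶠ[𝓝 x] fun _ => 0 := by
      filter_upwards [Iio_mem_nhds (lt_of_le_of_lt hx ha)] with y hy
      exact h0 y fun hy' => absurd hy'.1 (not_le.mpr hy)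
    rw [h0' x fun hy' => absurd (lt_of_lt_of_le ha hy'.1) (not_lt.mpr hx)]
    exact (hasDerivAt_const x (0 : ℝ)).congr_of_eventuallyEq this

/-- Near every point of (-∞, 0] the function vanishes identically, so regularity on (0, ∞) is
enough. This allows products with the profile, about which nothing is known at the origin. -/
theorem isHalfLineTest_one_of_hasDerivAt {F F' : ℝ → ℝ}
    (hF : ∀ x, 0 < x → HasDerivAt F (F' x) x) (hF' : ContinuousOn F' (Ioi 0)) {a b : ℝ}
    (ha : 0 < a) (hab : a ≤ b) (h0 : ∀ x, x ∉ Icc a b → F x = 0) : IsHalfLineTest 1 F := by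
  have hd : ∀ x, x ∉ Icc a b → deriv F x = 0 := fun x hx => deriv_eq_zero_of_notMem_Icc h0 hx
  have h1 : ∀ x, HasDerivAt F (deriv F x) x :=
    hasDerivAt_of_Ioi (fun x hx => (hF x hx).differentiableAt.hasDerivAt) ha h0 hd
  refine ⟨contDiff_one_iff_deriv.mpr ⟨fun x => (h1 x).differentiableAt,
    continuous_of_continuousOn_Ioi (hF'.congr fun x hx => (hF x hx).deriv) ha hd⟩, a, b, ha, hab, h0⟩

theorem IsHalfLineTest.integral_deriv_eq_zero {F : ℝ → ℝ} (hF : IsHalfLineTest 1 F) :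
    ∫ x, deriv F x = 0 := by
  obtain ⟨a, b, ha, hab, h0⟩ := hF.exists_Icc
  have hd : ∀ x, x ∉ Icc (a - 1) (b + 1) → deriv F x = 0 := fun x hx =>
    deriv_eq_zero_of_notMem_Icc h0 fun hx' => hx ⟨by linarith [hx'.1], by linarith [hx'.2]⟩
  rw [integral_eq_intervalIntegral_of_Icc (by linarith) hd,
    intervalIntegral.integral_deriv_eq_sub
      (fun y _ => (hF.contDiff.differentiable (by simp)).differentiableAt)
      ((hF.contDiff.continuous_deriv le_rfl).intervalIntegrable _ _),
    h0 _ (fun h => by linarith [h.2]), h0 _ (fun h => by linarith [h.1]), sub_zero]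

theorem IsHalfLineTest.mul_hasDerivAt {η p p' : ℝ → ℝ} (hη : IsHalfLineTest 1 η)
    (hp : ∀ x, 0 < x → HasDerivAt p (p' x) x) (hp' : ContinuousOn p' (Ioi 0)) :
    IsHalfLineTest 1 (fun x => p x * η x) := by
  obtain ⟨a, b, ha, hab, h0⟩ := hη.exists_Icc
  have hd : ∀ x, HasDerivAt η (deriv η x) x := fun x =>
    ((hη.contDiff.differentiable (by simp)) x).hasDerivAt
  refine isHalfLineTest_one_of_hasDerivAt (fun x hx => (hp x hx).mul (hd x)) ?_ ha hab
    fun x hx => by simp [h0 x hx]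
  have hpc : ContinuousOn p (Ioi 0) := fun x hx => (hp x hx).continuousAt.continuousWithinAt
  exact (hp'.mul hη.contDiff.continuous.continuousOn).add
    (hpc.mul (hη.contDiff.continuous_deriv le_rfl).continuousOn)

/-! ### The Hardy-type inequality forces growth. -/

/-- The power-like profile used to test the stability inequality: it behaves like `r ^ (1/2)` near
the origin and like `r ^ (-s)` near infinity. -/
def hardyProfile (s r : ℝ) : ℝ :=
  Real.exp (Real.log r / 2 - (s + 1 / 2) / 2 * Real.log (1 + r ^ 2))

/-- The logarithmic derivative of `hardyProfile` with respect to `log r`. -/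
def hardyExponent (s r : ℝ) : ℝ := 1 / 2 - (s + 1 / 2) * (r ^ 2 / (1 + r ^ 2))

theorem hardyProfile_pos (s r : ℝ) : 0 < hardyProfile s r := Real.exp_pos _

theorem hasDerivAt_hardyProfile (s : ℝ) {r : ℝ} (hr : 0 < r) :
    HasDerivAt (hardyProfile s) (hardyExponent s r * hardyProfile s r / r) r := by
  have h1 : HasDerivAt (fun r : ℝ => 1 + r ^ 2) (2 * r) r := by
    simpa using (hasDerivAt_pow 2 r).const_add 1
  have hne : (1 + r ^ 2 : ℝ) ≠ 0 := by positivity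
  have h2 := (((Real.hasDerivAt_log hr.ne').div_const 2).sub
    ((h1.log hne).const_mul ((s + 1 / 2) / 2))).exp
  refine h2.congr_deriv ?_
  unfold hardyExponent hardyProfile
  simp only [Pi.sub_apply]
  field_simp

/-- The exponent decreases with |r| from 1/2 towards -s without reaching it. The strict bound makes
s²η² - (rη')² positive for the profile wherever no cutoff acts. -/
theorem abs_hardyExponent_lt {s : ℝ} (hs : 1 ≤ s) (r : ℝ) : |hardyExponent s r| < s := by
  have h0 : 0 ≤ r ^ 2 / (1 + r ^ 2) := by positivity
  have h1 : r ^ 2 / (1 + r ^ 2) < 1 := by rw [div_lt_one (by positivity)]; linarith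
  unfold hardyExponent
  rw [abs_lt]
  constructor <;> nlinarith

/-- Controls the cost of the cutoff near the origin; the next bound, by r^(-s), controls the cutoff
near infinity. -/
theorem hardyProfile_sq_le (s : ℝ) (hs : 0 ≤ s) {r : ℝ} (hr : 0 < r) : hardyProfile s r ^ 2 ≤ r := by
  have h1 : 0 ≤ Real.log (1 + r ^ 2) := Real.log_nonneg (by nlinarith)
  calc hardyProfile s r ^ 2
      = Real.exp (2 * (Real.log r / 2 - (s + 1 / 2) / 2 * Real.log (1 + r ^ 2))) := by
        rw [hardyProfile, ← Real.exp_nat_mul]; norm_num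
    _ ≤ Real.exp (Real.log r) := by
        apply Real.exp_le_exp.mpr
        nlinarith
    _ = r := Real.exp_log hr

theorem hardyProfile_le_rpow (s : ℝ) (hs : 0 ≤ s) {r : ℝ} (hr : 0 < r) :
    hardyProfile s r ≤ r ^ (-s) := by
  have h1 : 2 * Real.log r ≤ Real.log (1 + r ^ 2) := by
    have : Real.log (r ^ 2) = 2 * Real.log r := by simp
    rw [← this]
    exact Real.log_le_log (by positivity) (by linarith)
  rw [Real.rpow_def_of_pos hr, hardyProfile]
  apply Real.exp_le_exp.mpr
  nlinarith

theorem deriv_smoothTransition_of_nonpos {x : ℝ} (h : x ≤ 0) : deriv Real.smoothTransition x = 0 := by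
  have hmin : IsLocalMin Real.smoothTransition x := by
    filter_upwards with y
    rw [Real.smoothTransition.zero_of_nonpos h]
    exact Real.smoothTransition.nonneg y
  exact hmin.deriv_eq_zero

theorem deriv_smoothTransition_of_one_le {x : ℝ} (h : 1 ≤ x) :
    deriv Real.smoothTransition x = 0 := by
  have hmax : IsLocalMax Real.smoothTransition x := by
    filter_upwards with y
    rw [Real.smoothTransition.one_of_one_le h]
    exact Real.smoothTransition.le_one y
  exact hmax.deriv_eq_zero

/-- The standard smooth step has bounded derivative. -/
theorem exists_bound_deriv_smoothTransition :
    ∃ K : ℝ, 0 ≤ K ∧ ∀ x, |deriv Real.smoothTransition x| ≤ K := by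
  have hc : Continuous (deriv Real.smoothTransition) :=
    (Real.smoothTransition.contDiff (n := 1)).continuous_deriv le_rfl
  obtain ⟨K, hK⟩ := isCompact_Icc.exists_bound_of_continuousOn (s := Icc (0 : ℝ) 1) hc.continuousOn
  refine ⟨max K 0, le_max_right _ _, fun x => ?_⟩
  by_cases hx : x ∈ Icc (0 : ℝ) 1
  · exact (hK x hx).trans (le_max_left _ _)
  · have : deriv Real.smoothTransition x = 0 := by
      rcases le_or_gt x 0 with h | h
      · exact deriv_smoothTransition_of_nonpos h
      · exact deriv_smoothTransition_of_one_le (not_lt.mp fun h1 => hx ⟨h.le, h1.le⟩)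
    rw [this]; simp

/-- If a bounded weight `ψ` satisfies the Hardy-type inequality with the constant `s ^ 2`, then its
mass over dyadic intervals grows at least like `R ^ (2 * s + 2)`. -/
theorem exists_growth_of_hardy {N : ℕ} (hN : 1 ≤ N) {s : ℝ} (hs : 1 ≤ s) {ψ : ℝ → ℝ}
    (hψc : ContinuousOn ψ (Ioi 0)) (hψ0 : ∀ r, 0 ≤ ψ r) (hψ1 : ∀ r, ψ r ≤ 1)
    (hardy : ∀ η, IsHalfLineTest 1 η →
      ∫ r, r ^ N * ψ r * (s ^ 2 * η r ^ 2 / r ^ 2 - deriv η r ^ 2) ≤ 0)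
    {r₁ : ℝ} (hr₁ : 0 < r₁) (hψr₁ : 0 < ψ r₁) :
    ∃ c : ℝ, 0 < c ∧ ∃ R₀ : ℝ, 2 < R₀ ∧ ∀ R : ℝ, R₀ ≤ R →
      c * R ^ (2 * s + 2) ≤ ∫ r in Icc R (2 * R), r ^ N * ψ r := by
  obtain ⟨K, hK0, hK⟩ := exists_bound_deriv_smoothTransition
  -- This is the integrand of the inequality for the profile without cutoffs; it is nonnegative, and
  -- at least half its value at `r₁` on an interval of length `δ`.
  set k : ℝ → ℝ := fun r =>
    r ^ N * ψ r * ((s ^ 2 - hardyExponent s r ^ 2) * hardyProfile s r ^ 2 / r ^ 2) with hk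
  have hgap : ∀ r, 0 < s ^ 2 - hardyExponent s r ^ 2 := fun r => by
    have h1 := abs_hardyExponent_lt hs r
    have h2 : hardyExponent s r ^ 2 < s ^ 2 := by
      rw [sq_lt_sq, abs_of_pos (by linarith : 0 < s)]; exact h1
    linarith
  have hprofc : ContinuousOn (hardyProfile s) (Ioi 0) := fun r hr =>
    (hasDerivAt_hardyProfile s hr).continuousAt.continuousWithinAt
  have hexpc : Continuous (hardyExponent s) := by
    unfold hardyExponent
    refine continuous_const.sub (continuous_const.mul ((continuous_pow 2).div₀ (by fun_prop) ?_))
    intro x; positivity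
  have hkc : ContinuousOn k (Ioi 0) := by
    refine ((continuous_pow N).continuousOn.mul hψc).mul (ContinuousOn.div ?_
      (continuous_pow 2).continuousOn fun r hr => pow_ne_zero 2 (ne_of_gt hr))
    exact (continuousOn_const.sub (hexpc.continuousOn.pow 2)).mul (hprofc.pow 2)
  have hk1 : 0 < k r₁ := by
    have := hgap r₁
    have := hardyProfile_pos s r₁
    simp only [hk]; positivity
  have hnear : ∀ᶠ r in 𝓝 r₁, k r₁ / 2 < k r ∧ 0 < r :=
    ((hkc.continuousAt (Ioi_mem_nhds hr₁)).eventually_const_lt (by linarith)).and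
      (Ioi_mem_nhds hr₁)
  obtain ⟨δ, hδ, hδk⟩ := Metric.eventually_nhds_iff.mp hnear
  set m := k r₁ / 2
  have hm : 0 < m := by positivity
  obtain ⟨a₀, ha₀e⟩ : ∃ x, x = r₁ - δ / 2 := ⟨_, rfl⟩
  obtain ⟨b₀, hb₀e⟩ : ∃ x, x = r₁ + δ / 2 := ⟨_, rfl⟩
  have hIcc : ∀ r ∈ Icc a₀ b₀, m ≤ k r ∧ 0 < r := fun r hr => by
    have := hδk (y := r) (by
      rw [Real.dist_eq, abs_lt]; constructor <;> linarith [hr.1, hr.2])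
    exact ⟨this.1.le, this.2⟩
  have ha₀ : 0 < a₀ := (hIcc a₀ ⟨le_rfl, by linarith⟩).2
  -- the loss produced by the cutoff near the origin
  set C := 4 * (K + s) ^ 2 with hC
  have hCpos : 0 < C := by
    have : 0 < K + s := by linarith
    positivity
  -- `ε ≤ 1/2` gives (2ε)^N ≤ 2ε; `4ε ≤ a₀` keeps the inner cutoff away from the interval of gain;
  -- the last condition makes the inner loss at most half of the gain `mδ`.
  obtain ⟨ε, hε0, hε1, hεa, hεC⟩ : ∃ ε : ℝ, 0 < ε ∧ ε ≤ 1 / 2 ∧ 4 * ε ≤ a₀ ∧ C * ε ≤ m * δ / 2 := by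
    refine ⟨min (1 / 2) (min (a₀ / 4) (m * δ / 2 / C)), ?_, min_le_left _ _, ?_, ?_⟩
    · exact lt_min (by norm_num) (lt_min (by linarith) (by positivity))
    · have : min (1 / 2) (min (a₀ / 4) (m * δ / 2 / C)) ≤ a₀ / 4 :=
        (min_le_right _ _).trans (min_le_left _ _)
      linarith
    · have : min (1 / 2) (min (a₀ / 4) (m * δ / 2 / C)) ≤ m * δ / 2 / C :=
        (min_le_right _ _).trans (min_le_right _ _)
      rwa [le_div_iff₀' hCpos] at this
  refine ⟨m * δ / 2 / (K + s) ^ 2, by positivity, max 3 (b₀ + 1),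
    lt_of_lt_of_le (by norm_num) (le_max_left _ _), fun R hR => ?_⟩
  have hR3 : 3 ≤ R := (le_max_left _ _).trans hR
  have hRb : b₀ + 1 ≤ R := (le_max_right _ _).trans hR
  have hR0 : 0 < R := by linarith
  -- `τ` rises from 0 to 1 on [ε, 2ε] and `χ` falls from 1 to 0 on [R, 2R].
  set τ : ℝ → ℝ := fun r => Real.smoothTransition (r / ε - 1) with hτ
  set χ : ℝ → ℝ := fun r => Real.smoothTransition (2 - r / R) with hχ
  have hTd : ∀ x, HasDerivAt Real.smoothTransition (deriv Real.smoothTransition x) x := fun x =>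
    ((Real.smoothTransition.contDiff (n := 1)).differentiable (by simp) x).hasDerivAt
  have hτd : ∀ r, HasDerivAt τ (deriv Real.smoothTransition (r / ε - 1) * (1 / ε)) r := fun r =>
    (hTd _).comp r (((hasDerivAt_id r).div_const ε).sub_const 1)
  have hχd : ∀ r, HasDerivAt χ (deriv Real.smoothTransition (2 - r / R) * (-(1 / R))) r := fun r =>
    (hTd _).comp r (((hasDerivAt_id r).div_const R).const_sub 2)
  have hTc : Continuous (deriv Real.smoothTransition) :=
    (Real.smoothTransition.contDiff (n := 1)).continuous_deriv le_rfl
  set η : ℝ → ℝ := fun r => τ r * χ r * hardyProfile s r with hη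
  set η' : ℝ → ℝ := fun r =>
    (deriv Real.smoothTransition (r / ε - 1) * (1 / ε) * χ r
      + τ r * (deriv Real.smoothTransition (2 - r / R) * (-(1 / R)))) * hardyProfile s r
      + τ r * χ r * (hardyExponent s r * hardyProfile s r / r) with hη'
  have hηd : ∀ r, 0 < r → HasDerivAt η (η' r) r := fun r hr =>
    ((hτd r).mul (hχd r)).mul (hasDerivAt_hardyProfile s hr)
  have hτc : Continuous τ := continuous_iff_continuousAt.mpr fun r => (hτd r).continuousAt
  have hχc : Continuous χ := continuous_iff_continuousAt.mpr fun r => (hχd r).continuousAt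
  have hη'c : ContinuousOn η' (Ioi 0) := by
    have h1 : Continuous fun r : ℝ => deriv Real.smoothTransition (r / ε - 1) :=
      hTc.comp (by fun_prop)
    have h2 : Continuous fun r : ℝ => deriv Real.smoothTransition (2 - r / R) :=
      hTc.comp (by fun_prop)
    refine ContinuousOn.add (ContinuousOn.mul ?_ hprofc) (ContinuousOn.mul ?_ ?_)
    · exact (((h1.mul continuous_const).mul hχc).add
        (hτc.mul (h2.mul continuous_const))).continuousOn
    · exact (hτc.mul hχc).continuousOn
    · exact (hexpc.continuousOn.mul hprofc).div continuousOn_id fun r hr => ne_of_gt hr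
  have hτ0 : ∀ r, r ≤ ε → r / ε - 1 ≤ 0 := fun r h => by
    rw [sub_nonpos, div_le_one hε0]; exact h
  have hτ1 : ∀ r, 2 * ε ≤ r → 1 ≤ r / ε - 1 := fun r h => by
    have : 2 ≤ r / ε := by rw [le_div_iff₀ hε0]; exact h
    linarith
  have hχ1 : ∀ r, r ≤ R → 1 ≤ 2 - r / R := fun r h => by
    have : r / R ≤ 1 := by rw [div_le_one hR0]; exact h
    linarith
  have hχ0 : ∀ r, 2 * R ≤ r → 2 - r / R ≤ 0 := fun r h => by
    have : 2 ≤ r / R := by rw [le_div_iff₀ hR0]; exact h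
    linarith
  have hη0 : ∀ r, r ∉ Icc ε (2 * R) → η r = 0 := by
    intro r hr
    rcases lt_or_ge r ε with h | h
    · simp [hη, hτ, Real.smoothTransition.zero_of_nonpos (hτ0 r h.le)]
    · have h2 : 2 * R < r := by by_contra h2; exact hr ⟨h, not_lt.mp h2⟩
      simp [hη, hχ, Real.smoothTransition.zero_of_nonpos (hχ0 r h2.le)]
  have hηt : IsHalfLineTest 1 η :=
    isHalfLineTest_one_of_hasDerivAt hηd hη'c hε0 (by linarith) hη0
  have hmain := hardy η hηt
  have hτb : ∀ r, 0 ≤ τ r ∧ τ r ≤ 1 := fun r =>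
    ⟨Real.smoothTransition.nonneg _, Real.smoothTransition.le_one _⟩
  have hχb : ∀ r, 0 ≤ χ r ∧ χ r ≤ 1 := fun r =>
    ⟨Real.smoothTransition.nonneg _, Real.smoothTransition.le_one _⟩
  have hexpb : ∀ r, |hardyExponent s r| ≤ s := fun r => (abs_hardyExponent_lt hs r).le
  set L := (K + s) ^ 2 * R ^ (-(2 * s + 2)) with hL
  have hL0 : 0 ≤ L := by positivity
  -- Pointwise balance: gain at least `m` on [a₀, b₀], loss at most `C` on [ε, 2ε], loss at most `L
  -- r^N ψ` on [R, 2R], and a nonnegative integrand elsewhere. Integration gives `δm - εC - L ∫ r^N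
  -- ψ ≤ 0`.
  have hpt : ∀ r,
      (Icc a₀ b₀).indicator (fun _ => m) r - (Icc ε (2 * ε)).indicator (fun _ => C) r
        - (Icc R (2 * R)).indicator (fun r => L * (r ^ N * ψ r)) r
      ≤ r ^ N * ψ r * (s ^ 2 * η r ^ 2 / r ^ 2 - deriv η r ^ 2) := by
    intro r
    have hI1 : r ∉ Icc a₀ b₀ → (Icc a₀ b₀).indicator (fun _ => m) r = 0 :=
      fun h => indicator_of_notMem h _
    have hI2 : 0 ≤ (Icc ε (2 * ε)).indicator (fun _ => C) r :=
      indicator_nonneg (fun _ _ => hCpos.le) r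
    have hI3 : 0 ≤ (Icc R (2 * R)).indicator (fun r => L * (r ^ N * ψ r)) r :=
      indicator_nonneg (fun x hx => mul_nonneg hL0 (mul_nonneg
        (pow_nonneg (hR0.le.trans hx.1) _) (hψ0 x))) r
    by_cases hr : r ∈ Icc ε (2 * R)
    swap
    · rw [hη0 r hr, deriv_eq_zero_of_notMem_Icc hη0 hr, hI1 fun h =>
        hr ⟨by linarith [h.1], by linarith [h.2]⟩]
      simp only [ne_eq, OfNat.ofNat_ne_zero, not_false_eq_true, zero_pow, mul_zero, zero_div,
        sub_self]
      linarith
    have hr0 : 0 < r := hε0.trans_le hr.1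
    have hw0 : 0 ≤ r ^ N * ψ r := mul_nonneg (pow_nonneg hr0.le _) (hψ0 r)
    have hh0 := hardyProfile_pos s r
    rw [(hηd r hr0).deriv]
    -- a bound on `η'` bounds the integrand from below
    have hlow : ∀ M, |η' r| ≤ M →
        -(r ^ N * ψ r * M ^ 2) ≤ r ^ N * ψ r * (s ^ 2 * η r ^ 2 / r ^ 2 - η' r ^ 2) := by
      intro M hM
      have h1 : η' r ^ 2 ≤ M ^ 2 := by
        rw [← sq_abs]; exact pow_le_pow_left₀ (abs_nonneg _) hM 2
      have h2 : 0 ≤ s ^ 2 * η r ^ 2 / r ^ 2 := by positivity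
      have := mul_le_mul_of_nonneg_left (by linarith : -M ^ 2 ≤ s ^ 2 * η r ^ 2 / r ^ 2 - η' r ^ 2)
        hw0
      linarith
    rcases le_or_gt r (2 * ε) with h2ε | h2ε
    · have hrR : r ≤ R := by linarith
      have e1 : χ r = 1 := Real.smoothTransition.one_of_one_le (hχ1 r hrR)
      have e2 : deriv Real.smoothTransition (2 - r / R) = 0 :=
        deriv_smoothTransition_of_one_le (hχ1 r hrR)
      have hb : |η' r| ≤ (K + s) / ε * hardyProfile s r := by
        have : η' r = (deriv Real.smoothTransition (r / ε - 1) * (1 / ε)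
            + τ r * hardyExponent s r * (1 / r)) * hardyProfile s r := by
          simp only [hη', e1, e2]; ring
        rw [this, abs_mul, abs_of_pos hh0]
        refine mul_le_mul_of_nonneg_right ?_ hh0.le
        calc _ ≤ |deriv Real.smoothTransition (r / ε - 1)| * (1 / ε)
              + |τ r| * |hardyExponent s r| * (1 / r) := by
              refine (abs_add_le _ _).trans (le_of_eq ?_)
              rw [abs_mul, abs_mul, abs_mul, abs_of_pos (by positivity : 0 < 1 / ε),
                abs_of_pos (by positivity : 0 < 1 / r)]
          _ ≤ K * (1 / ε) + 1 * s * (1 / ε) := by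
              have := (hτb r).1
              have h3 : |τ r| ≤ 1 := by rw [abs_of_nonneg this]; exact (hτb r).2
              have h4 := one_div_le_one_div_of_le hε0 hr.1
              have := hK (r / ε - 1)
              have := hexpb r
              gcongr
          _ = (K + s) / ε := by ring
      have h1 := hlow _ hb
      -- The factor ε^(-2) from the cutoff is absorbed by r^N ≤ 2ε, where `1 ≤ N` enters, and by the
      -- squared profile, at most 2ε. The bound is thus independent of `ε`, on an interval of length
      -- `ε`.
      have h2 : r ^ N * ψ r * ((K + s) / ε * hardyProfile s r) ^ 2 ≤ C := by
        have a1 : r ^ N ≤ 2 * ε := by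
          calc r ^ N ≤ (2 * ε) ^ N := pow_le_pow_left₀ hr0.le h2ε N
            _ ≤ (2 * ε) ^ 1 := pow_le_pow_of_le_one (by linarith) (by linarith) hN
            _ = 2 * ε := pow_one _
        have a2 : hardyProfile s r ^ 2 ≤ 2 * ε := (hardyProfile_sq_le s (by linarith) hr0).trans h2ε
        calc r ^ N * ψ r * ((K + s) / ε * hardyProfile s r) ^ 2
            = r ^ N * ψ r * (((K + s) / ε) ^ 2 * hardyProfile s r ^ 2) := by ring
          _ ≤ 2 * ε * 1 * (((K + s) / ε) ^ 2 * (2 * ε)) := by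
              have := hψ1 r
              have := hψ0 r
              gcongr
          _ = C := by rw [hC]; field_simp; ring
      have h3 : (Icc ε (2 * ε)).indicator (fun _ => C) r = C :=
        indicator_of_mem (show r ∈ Icc ε (2 * ε) from ⟨hr.1, h2ε⟩) _
      rw [hI1 fun h => by linarith [h.1], h3]
      linarith
    · have e1 : τ r = 1 := Real.smoothTransition.one_of_one_le (hτ1 r h2ε.le)
      have e2 : deriv Real.smoothTransition (r / ε - 1) = 0 :=
        deriv_smoothTransition_of_one_le (hτ1 r h2ε.le)
      rcases lt_or_ge r R with hrR | hrR
      · have e3 : χ r = 1 := Real.smoothTransition.one_of_one_le (hχ1 r hrR.le)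
        have e4 : deriv Real.smoothTransition (2 - r / R) = 0 :=
          deriv_smoothTransition_of_one_le (hχ1 r hrR.le)
        have hkr : r ^ N * ψ r * (s ^ 2 * η r ^ 2 / r ^ 2 - η' r ^ 2) = k r := by
          simp only [hη, hη', hk, e1, e2, e3, e4]; field_simp; ring
        rw [hkr]
        have hk0 : 0 ≤ k r := by
          have := hgap r
          simp only [hk]
          exact mul_nonneg hw0 (by positivity)
        have : (Icc a₀ b₀).indicator (fun _ => m) r ≤ k r := by
          by_cases h : r ∈ Icc a₀ b₀
          · rw [indicator_of_mem h]; exact (hIcc r h).1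
          · rw [hI1 h]; exact hk0
        linarith
      · have hb : |η' r| ≤ (K + s) * R ^ (-(s + 1)) := by
          have : η' r = (deriv Real.smoothTransition (2 - r / R) * (-(1 / R))
              + χ r * hardyExponent s r * (1 / r)) * hardyProfile s r := by
            simp only [hη', e1, e2]; ring
          rw [this, abs_mul, abs_of_pos hh0]
          calc _ ≤ (|deriv Real.smoothTransition (2 - r / R)| * (1 / R)
                + |χ r| * |hardyExponent s r| * (1 / r)) * hardyProfile s r := by
                refine mul_le_mul_of_nonneg_right ?_ hh0.le
                refine (abs_add_le _ _).trans (le_of_eq ?_)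
                rw [abs_mul, abs_mul, abs_mul, abs_neg, abs_of_pos (by positivity : 0 < 1 / R),
                  abs_of_pos (by positivity : 0 < 1 / r)]
            _ ≤ (K * (1 / R) + 1 * s * (1 / R)) * R ^ (-s) := by
                have := (hχb r).1
                have h3 : |χ r| ≤ 1 := by rw [abs_of_nonneg this]; exact (hχb r).2
                have h4 := one_div_le_one_div_of_le hR0 hrR
                have := hK (2 - r / R)
                have := hexpb r
                have h5 : hardyProfile s r ≤ R ^ (-s) :=
                  (hardyProfile_le_rpow s (by linarith) hr0).trans
                    (Real.rpow_le_rpow_of_nonpos hR0 hrR (by linarith))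
                gcongr
            _ = (K + s) * R ^ (-(s + 1)) := by
                rw [show -(s + 1) = -s - 1 by ring, Real.rpow_sub_one hR0.ne']; ring
        have h1 := hlow _ hb
        have h3 : (Icc R (2 * R)).indicator (fun r => L * (r ^ N * ψ r)) r = L * (r ^ N * ψ r) :=
          indicator_of_mem (show r ∈ Icc R (2 * R) from ⟨hrR, hr.2⟩) _
        have h4 : ((K + s) * R ^ (-(s + 1))) ^ 2 = L := by
          rw [hL, mul_pow, ← Real.rpow_mul_natCast hR0.le]; congr 2; push_cast; ring
        rw [hI1 fun h => by linarith [h.2], h3]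
        rw [h4] at h1
        linarith
  have hwc : ContinuousOn (fun r => r ^ N * ψ r) (Ioi 0) := (continuous_pow N).continuousOn.mul hψc
  have hwint : IntegrableOn (fun r => r ^ N * ψ r) (Icc R (2 * R)) :=
    (hwc.mono fun r hr => hR0.trans_le hr.1).integrableOn_compact isCompact_Icc
  have i1 : Integrable ((Icc a₀ b₀).indicator fun _ => m) :=
    (integrable_indicator_iff measurableSet_Icc).mpr (by simp)
  have i2 : Integrable ((Icc ε (2 * ε)).indicator fun _ => C) :=
    (integrable_indicator_iff measurableSet_Icc).mpr (by simp)
  have i3 : Integrable ((Icc R (2 * R)).indicator fun r => L * (r ^ N * ψ r)) :=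
    (integrable_indicator_iff measurableSet_Icc).mpr (hwint.const_mul L)
  have i4 : Integrable fun r => r ^ N * ψ r * (s ^ 2 * η r ^ 2 / r ^ 2 - deriv η r ^ 2) := by
    refine integrable_mul_of_Icc (hwc.locallyIntegrableOn measurableSet_Ioi) hε0 (b := 2 * R) ?_
      fun r hr => by simp [hη0 r hr, deriv_eq_zero_of_notMem_Icc hη0 hr]
    refine ContinuousOn.sub (ContinuousOn.div ?_ (continuous_pow 2).continuousOn fun r hr =>
      pow_ne_zero 2 (hε0.trans_le hr.1).ne')
      ((hηt.contDiff.continuous_deriv le_rfl).pow 2).continuousOn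
    exact (continuous_const.mul (hηt.contDiff.continuous.pow 2)).continuousOn
  have i12 : Integrable fun r => (Icc a₀ b₀).indicator (fun _ => m) r
      - (Icc ε (2 * ε)).indicator (fun _ => C) r := i1.sub i2
  have hint := integral_mono (i12.sub i3) i4 hpt
  have hval : ∫ r, ((Icc a₀ b₀).indicator (fun _ => m) r - (Icc ε (2 * ε)).indicator (fun _ => C) r
        - (Icc R (2 * R)).indicator (fun r => L * (r ^ N * ψ r)) r)
      = δ * m - ε * C - L * ∫ r in Icc R (2 * R), r ^ N * ψ r := by
    rw [integral_sub i12 i3, integral_sub i1 i2, integral_indicator measurableSet_Icc,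
      integral_indicator measurableSet_Icc, integral_indicator measurableSet_Icc,
      integral_const_mul L, setIntegral_const, setIntegral_const, Real.volume_real_Icc_of_le
        (by linarith), Real.volume_real_Icc_of_le (by linarith), ha₀e, hb₀e]
    simp only [smul_eq_mul]
    ring
  have hfin : m * δ / 2 ≤ L * ∫ r in Icc R (2 * R), r ^ N * ψ r := by
    have : (δ * m - ε * C - L * ∫ r in Icc R (2 * R), r ^ N * ψ r) ≤ 0 := by
      rw [← hval]; exact hint.trans hmain
    linarith
  have hKs : 0 < K + s := by linarith
  have hRp : 0 < R ^ (2 * s + 2) := Real.rpow_pos_of_pos hR0 _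
  rw [hL, Real.rpow_neg hR0.le] at hfin
  rw [div_mul_eq_mul_div, div_le_iff₀ (by positivity)]
  calc m * δ / 2 * R ^ (2 * s + 2)
      ≤ ((K + s) ^ 2 * (R ^ (2 * s + 2))⁻¹ * ∫ r in Icc R (2 * R), r ^ N * ψ r)
          * R ^ (2 * s + 2) := mul_le_mul_of_nonneg_right hfin hRp.le
    _ = _ := by field_simp

/-! ### From smooth to C¹ test functions. -/

open scoped Convolution in
/-- Mollification of a `C^1` function with compact support in `(0, ∞)`. -/
theorem IsHalfLineTest.exists_smooth_approx {q : ℝ → ℝ} (hq : IsHalfLineTest 1 q) :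
    ∃ (Q : ℕ → ℝ → ℝ) (a b C : ℝ), 0 < a ∧ a ≤ b ∧ (∀ k, IsHalfLineTest ∞ (Q k)) ∧
      (∀ k x, x ∉ Icc a b → Q k x = 0) ∧ (∀ k x, |Q k x| ≤ C) ∧ (∀ k x, |deriv (Q k) x| ≤ C) ∧
      (∀ x, Tendsto (fun k => Q k x) atTop (𝓝 (q x))) ∧
      ∀ x, Tendsto (fun k => deriv (Q k) x) atTop (𝓝 (deriv q x)) := by
  obtain ⟨a, b, ha, hab, h0⟩ := hq.exists_Icc
  have hqc : HasCompactSupport q := hasCompactSupport_of_Icc h0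
  have hdc : Continuous (deriv q) := hq.contDiff.continuous_deriv le_rfl
  have hd0 : ∀ x, x ∉ Icc a b → deriv q x = 0 := fun x hx => deriv_eq_zero_of_notMem_Icc h0 hx
  obtain ⟨M₁, hM₁⟩ := hqc.exists_bound_of_continuous hq.contDiff.continuous
  obtain ⟨M₂, hM₂⟩ := (hasCompactSupport_of_Icc hd0).exists_bound_of_continuous hdc
  set M := max M₁ M₂
  -- Radii at most a/2 keep all the mollified functions supported in [a/2, b + a/2], inside (0, ∞).
  let φ : ℕ → ContDiffBump (0 : ℝ) := fun k =>
    ⟨a / 2 / (k + 1) / 2, a / 2 / (k + 1), by positivity, by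
      have : 0 < a / 2 / ((k : ℝ) + 1) := by positivity
      linarith⟩
  have hφ : Tendsto (fun k => (φ k).rOut) atTop (𝓝 0) := by
    have := (tendsto_one_div_add_atTop_nhds_zero_nat (𝕜 := ℝ)).const_mul (a / 2)
    simpa [φ, div_eq_mul_inv] using this
  have hrOut : ∀ k, (φ k).rOut ≤ a / 2 := fun k =>
    div_le_self (by positivity) (by
      have : (0 : ℝ) ≤ k := k.cast_nonneg
      linarith)
  set Q : ℕ → ℝ → ℝ := fun k =>
    ((φ k).normed volume ⋆[ContinuousLinearMap.lsmul ℝ ℝ, volume] q) with hQ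
  have hloc : ∀ k, LocallyIntegrable ((φ k).normed volume) volume := fun k =>
    (φ k).continuous_normed.locallyIntegrable
  have hQd : ∀ k x, HasDerivAt (Q k)
      (((φ k).normed volume ⋆[ContinuousLinearMap.lsmul ℝ ℝ, volume] deriv q) x) x := fun k x =>
    hqc.hasDerivAt_convolution_right _ (hloc k) hq.contDiff x
  have hQ0 : ∀ k x, x ∉ Icc (a / 2) (b + a / 2) → Q k x = 0 := by
    intro k x hx
    have hball : ∀ y ∈ Metric.ball x (φ k).rOut, q y = 0 := fun y hy => h0 y fun hy' => by
      rw [Metric.mem_ball, Real.dist_eq, abs_lt] at hy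
      have := hrOut k
      exact hx ⟨by linarith [hy'.1], by linarith [hy'.2]⟩
    have hx0 : q x = 0 := hball x (Metric.mem_ball_self (φ k).rOut_pos)
    have := (φ k).normed_convolution_eq_right (μ := volume) (g := q) (x₀ := x)
      fun y hy => by rw [hball y hy, hx0]
    rw [hQ]
    simpa [hx0] using this
  -- The crude bound `3M` is `M` for the function itself plus `2M` for its oscillation; the same
  -- works for the derivative.
  refine ⟨Q, a / 2, b + a / 2, 3 * M, by positivity, by linarith, fun k => ⟨?_, a / 2, b + a / 2,
    by positivity, by linarith, hQ0 k⟩, hQ0, ?_, ?_, ?_, ?_⟩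
  · exact (φ k).hasCompactSupport_normed.contDiff_convolution_left _ (φ k).contDiff_normed
      hq.contDiff.continuous.locallyIntegrable
  · intro k x
    have hb : ∀ y, |q y| ≤ M := fun y => (hM₁ y).trans (le_max_left _ _)
    have := (φ k).dist_normed_convolution_le (μ := volume) (g := q) (x₀ := x) (ε := 2 * M)
      hq.contDiff.continuous.aestronglyMeasurable fun y _ => by
        rw [Real.dist_eq]
        linarith [abs_sub (q y) (q x), hb y, hb x]
    rw [Real.dist_eq] at this
    have h2 := abs_sub_abs_le_abs_sub (Q k x) (q x)
    have := hb x
    simp only [hQ] at h2 ⊢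
    linarith
  · intro k x
    rw [(hQd k x).deriv]
    have hb : ∀ y, |deriv q y| ≤ M := fun y => (hM₂ y).trans (le_max_right _ _)
    have := (φ k).dist_normed_convolution_le (μ := volume) (g := deriv q) (x₀ := x) (ε := 2 * M)
      hdc.aestronglyMeasurable fun y _ => by
        rw [Real.dist_eq]
        linarith [abs_sub (deriv q y) (deriv q x), hb y, hb x]
    rw [Real.dist_eq] at this
    have h2 := abs_sub_abs_le_abs_sub
      (((φ k).normed volume ⋆[ContinuousLinearMap.lsmul ℝ ℝ, volume] deriv q) x) (deriv q x)
    have := hb x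
    linarith
  · intro x
    exact ContDiffBump.convolution_tendsto_right_of_continuous hφ hq.contDiff.continuous x
  · intro x
    simp_rw [(hQd _ x).deriv]
    exact ContDiffBump.convolution_tendsto_right_of_continuous hφ hdc x

/-- Dominated convergence: the uniform bound and the common compact support give the majorant |A| C²
on [a, b]. -/
theorem tendsto_integral_mul_sq {A : ℝ → ℝ} (hA : LocallyIntegrableOn A (Ioi 0))
    {Q : ℕ → ℝ → ℝ} {q : ℝ → ℝ} {a b C : ℝ} (ha : 0 < a) (hQc : ∀ k, Continuous (Q k))
    (h0 : ∀ k x, x ∉ Icc a b → Q k x = 0) (hC : ∀ k x, |Q k x| ≤ C)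
    (hlim : ∀ x, Tendsto (fun k => Q k x) atTop (𝓝 (q x))) :
    Tendsto (fun k => ∫ x, A x * Q k x ^ 2) atTop (𝓝 (∫ x, A x * q x ^ 2)) := by
  have hs : Icc a b ⊆ Ioi (0 : ℝ) := fun x hx => lt_of_lt_of_le ha hx.1
  have hAi : IntegrableOn A (Icc a b) := hA.integrableOn_compact_subset hs isCompact_Icc
  refine tendsto_integral_of_dominated_convergence
    ((Icc a b).indicator fun x => |A x| * C ^ 2) (fun k => ?_) ?_ (fun k => ?_) ?_
  · exact (integrable_mul_of_Icc hA ha (b := b) ((hQc k).pow 2).continuousOn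
      fun x hx => by simp [h0 k x hx]).aestronglyMeasurable
  · exact (integrable_indicator_iff measurableSet_Icc).mpr (hAi.norm.mul_const _)
  · refine Eventually.of_forall fun x => ?_
    by_cases hx : x ∈ Icc a b
    · rw [indicator_of_mem hx, Real.norm_eq_abs, abs_mul, abs_pow]
      exact mul_le_mul_of_nonneg_left (pow_le_pow_left₀ (abs_nonneg _) (hC k x) 2) (abs_nonneg _)
    · rw [indicator_of_notMem hx, h0 k x hx]; simp
  · exact Eventually.of_forall fun x => ((hlim x).pow 2).const_mul _

/-- A weighted quadratic inequality for smooth test functions extends to `C^1` test functions. -/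
theorem quadratic_le_of_smooth {A B : ℝ → ℝ} (hA : LocallyIntegrableOn A (Ioi 0))
    (hB : LocallyIntegrableOn B (Ioi 0))
    (h : ∀ q, IsHalfLineTest ∞ q → ∫ x, A x * q x ^ 2 ≤ ∫ x, B x * deriv q x ^ 2)
    {q : ℝ → ℝ} (hq : IsHalfLineTest 1 q) :
    ∫ x, A x * q x ^ 2 ≤ ∫ x, B x * deriv q x ^ 2 := by
  obtain ⟨Q, a, b, C, ha, _, hQ, h0, hC, hC', hlim, hlim'⟩ := hq.exists_smooth_approx
  refine le_of_tendsto_of_tendsto'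
    (tendsto_integral_mul_sq hA ha (fun k => (hQ k).contDiff.continuous) h0 hC hlim)
    (tendsto_integral_mul_sq hB ha (fun k => (hQ k).contDiff.continuous_deriv (by simp))
      (fun k x hx => deriv_eq_zero_of_notMem_Icc (h0 k) hx) hC' hlim') fun k => h _ (hQ k)

/-! ### The Hardy-type inequality from stability. -/

/-- The map p ↦ p/√(1 + p²) is inverted by w ↦ w/√(1 - w²), so differentiability passes from the
flux, where the equation provides it, back to p. -/
theorem hasDerivAt_of_div_sqrt {p w : ℝ → ℝ} {w' x : ℝ}
    (hw : ∀ᶠ y in 𝓝 x, w y = p y / √(1 + p y ^ 2)) (hd : HasDerivAt w w' x) :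
    HasDerivAt p (w' * √(1 + p x ^ 2) ^ 3) x := by
  have hpw : ∀ t : ℝ, 1 - (t / √(1 + t ^ 2)) ^ 2 = (1 / √(1 + t ^ 2)) ^ 2 := fun t => by
    have h1 : √(1 + t ^ 2) ^ 2 = 1 + t ^ 2 := Real.sq_sqrt (by positivity)
    have h2 : (1 + t ^ 2 : ℝ) ≠ 0 := by positivity
    rw [div_pow, div_pow, h1]; field_simp; ring
  have hsq : ∀ t : ℝ, √(1 - (t / √(1 + t ^ 2)) ^ 2) = 1 / √(1 + t ^ 2) := fun t => by
    rw [hpw, Real.sqrt_sq (by positivity)]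
  have hpe : p =ᶠ[𝓝 x] fun y => w y / √(1 - w y ^ 2) := by
    filter_upwards [hw] with y hy
    have : 0 < √(1 + p y ^ 2) := Real.sqrt_pos.mpr (by positivity)
    rw [hy, hsq]; field_simp
  have hS : 0 < √(1 + p x ^ 2) := Real.sqrt_pos.mpr (by positivity)
  have hwx := hw.self_of_nhds
  have hpos : 0 < 1 - w x ^ 2 := by rw [hwx, hpw]; positivity
  have hd1 : HasDerivAt (fun y => 1 - w y ^ 2) (-(2 * w x * w')) x := by
    refine ((hd.pow 2).const_sub 1).congr_deriv ?_
    simp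
  have hd2 := hd.div (hd1.sqrt hpos.ne') (Real.sqrt_pos.mpr hpos).ne'
  refine (hd2.congr_of_eventuallyEq hpe).congr_deriv ?_
  have e : √(1 - w x ^ 2) = 1 / √(1 + p x ^ 2) := by rw [hwx, hsq]
  rw [e]
  have hSS : √(1 + p x ^ 2) ^ 2 = 1 + p x ^ 2 := Real.sq_sqrt (by positivity)
  rw [hwx]
  field_simp
  rw [hSS]
  ring

/-- Testing the stability inequality of a radial solution with `p * η`, where `p` is the radial
derivative, gives a Hardy-type inequality for the weight `p ^ 2 / (1 + p ^ 2) ^ (3 / 2)`. -/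
theorem hardy_of_radial_stable {N : ℕ} {f : ℝ → ℝ} (hf : ContDiff ℝ 1 f) {g p : ℝ → ℝ}
    (hg : ∀ r, 0 < r → HasDerivAt g (p r) r) (hp : ContinuousOn p (Ioi 0))
    (heq : ∀ φ, IsHalfLineTest ∞ φ →
      ∫ r, r ^ N * (p r / √(1 + p r ^ 2)) * deriv φ r = ∫ r, r ^ N * f (g r) * φ r)
    (hst : ∀ q, IsHalfLineTest ∞ q →
      ∫ r, r ^ N * deriv f (g r) * q r ^ 2
        ≤ ∫ r, r ^ N * (1 / √(1 + p r ^ 2) ^ 3) * deriv q r ^ 2)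
    {η : ℝ → ℝ} (hη : IsHalfLineTest 1 η) :
    ∫ r, r ^ N * (p r ^ 2 / √(1 + p r ^ 2) ^ 3) * (N * η r ^ 2 / r ^ 2 - deriv η r ^ 2) ≤ 0 := by
  set S : ℝ → ℝ := fun r => √(1 + p r ^ 2) with hS
  have hSpos : ∀ r, 0 < S r := fun r => Real.sqrt_pos.mpr (by positivity)
  have hSsq : ∀ r, S r ^ 2 = 1 + p r ^ 2 := fun r => Real.sq_sqrt (by positivity)
  have hSc : ContinuousOn S (Ioi 0) := (continuousOn_const.add (hp.pow 2)).sqrt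
  set w : ℝ → ℝ := fun r => p r / S r with hw
  have hwc : ContinuousOn w (Ioi 0) := hp.div hSc fun r _ => (hSpos r).ne'
  have hgc : ContinuousOn g (Ioi 0) := fun r hr => (hg r hr).continuousAt.continuousWithinAt
  have hfgc : ContinuousOn (fun r => f (g r)) (Ioi 0) := hf.continuous.comp_continuousOn hgc
  have hf'gc : ContinuousOn (fun r => deriv f (g r)) (Ioi 0) :=
    (hf.continuous_deriv le_rfl).comp_continuousOn hgc
  have hNc : ContinuousOn (fun r : ℝ => r ^ N) (Ioi 0) := (continuous_pow N).continuousOn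
  -- the flux `r ^ N * w` is continuously differentiable
  have hWc : ContinuousOn (fun r => r ^ N * w r) (Ioi 0) := hNc.mul hwc
  have hHc : ContinuousOn (fun r => -(r ^ N * f (g r))) (Ioi 0) := (hNc.mul hfgc).neg
  -- The weak equation makes the flux almost everywhere a primitive of the continuous function -r^N
  -- f(g); both sides are continuous, so they agree everywhere and the flux is C¹.
  have hWd : ∀ r, 0 < r → HasDerivAt (fun r => r ^ N * w r) (-(r ^ N * f (g r))) r := by
    obtain ⟨hc, c, hcae⟩ := ae_eq_primitive_of_weakDeriv
      (hWc.locallyIntegrableOn measurableSet_Ioi) (hHc.locallyIntegrableOn measurableSet_Ioi)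
      fun φ hφ => by
        rw [heq φ hφ, ← integral_neg]
        congr 1; ext r; ring
    have heqOn : EqOn (fun r => r ^ N * w r)
        (fun r => c + ∫ t in (1 : ℝ)..r, -(t ^ N * f (g t))) (Ioi 0) := by
      refine Measure.eqOn_open_of_ae_eq (μ := volume) ?_ isOpen_Ioi hWc (continuousOn_const.add hc)
      rw [Filter.EventuallyEq, ae_restrict_iff' measurableSet_Ioi]
      exact hcae
    intro r hr
    exact (hasDerivAt_primitive_of_continuousOn hHc hr c).congr_of_eventuallyEq
      (heqOn.eventuallyEq_of_mem (Ioi_mem_nhds hr))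
  set w₁ : ℝ → ℝ := fun r => -f (g r) - N * w r / r with hw₁
  have hwd : ∀ r, 0 < r → HasDerivAt w (w₁ r) r := by
    intro r hr
    have h1 := (hWd r hr).div (hasDerivAt_pow N r) (pow_ne_zero N hr.ne')
    have h2 : w =ᶠ[𝓝 r] fun r => (r ^ N * w r) / r ^ N := by
      filter_upwards [Ioi_mem_nhds hr] with y hy
      rw [mul_div_cancel_left₀ _ (pow_ne_zero N (ne_of_gt hy))]
    refine (h1.congr_of_eventuallyEq h2).congr_deriv ?_
    simp only [hw₁]
    rcases N with _ | N
    · simp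
    · have : r ^ (N + 1) ≠ 0 := pow_ne_zero _ hr.ne'
      simp only [Nat.add_sub_cancel]
      field_simp
      ring
  have hw₁c : ContinuousOn w₁ (Ioi 0) :=
    hfgc.neg.sub ((continuousOn_const.mul hwc).div continuousOn_id fun r hr => ne_of_gt hr)
  set p₁ : ℝ → ℝ := fun r => w₁ r * S r ^ 3 with hp₁
  have hpd : ∀ r, 0 < r → HasDerivAt p (p₁ r) r := fun r hr =>
    hasDerivAt_of_div_sqrt (Eventually.of_forall fun _ => rfl) (hwd r hr)
  have hp₁c : ContinuousOn p₁ (Ioi 0) := hw₁c.mul (hSc.pow 3)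
  -- The expression for w' involves only f(g), w and r, all now C¹, so w is twice differentiable
  -- although f is merely C¹. This is the linearized equation for p.
  set w₂ : ℝ → ℝ := fun r => -(deriv f (g r) * p r) - N * ((w₁ r * r - w r * 1) / r ^ 2) with hw₂
  have hw₁d : ∀ r, 0 < r → HasDerivAt w₁ (w₂ r) r := by
    intro r hr
    have h1 : HasDerivAt (fun r => f (g r)) (deriv f (g r) * p r) r :=
      ((hf.differentiable (by simp)) (g r)).hasDerivAt.comp r (hg r hr)
    have h2 := ((hwd r hr).div (hasDerivAt_id r) hr.ne').const_mul (N : ℝ)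
    refine (h1.neg.sub h2).congr_of_eventuallyEq (Eventually.of_forall fun y => ?_)
    simp only [hw₁, Pi.sub_apply, Pi.neg_apply, Pi.div_apply, id]
    ring
  have hw₂c : ContinuousOn w₂ (Ioi 0) := by
    refine (hf'gc.mul hp).neg.sub (continuousOn_const.mul (ContinuousOn.div ?_
      (continuous_pow 2).continuousOn fun r hr => pow_ne_zero 2 (ne_of_gt hr)))
    exact (hw₁c.mul continuousOn_id).sub (hwc.mul continuousOn_const)
  -- test functions
  obtain ⟨a, b, ha, hab, h0⟩ := hη.exists_Icc
  have hηd : ∀ r, HasDerivAt η (deriv η r) r := fun r =>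
    ((hη.contDiff.differentiable (by simp)) r).hasDerivAt
  have hηc := hη.contDiff.continuous
  have hη'c := hη.contDiff.continuous_deriv le_rfl
  have hη'0 : ∀ r, r ∉ Icc a b → deriv η r = 0 := fun r hr => deriv_eq_zero_of_notMem_Icc h0 hr
  have hq : IsHalfLineTest 1 (fun r => p r * η r) := hη.mul_hasDerivAt hpd hp₁c
  have hqd : ∀ r, 0 < r → deriv (fun r => p r * η r) r = p₁ r * η r + p r * deriv η r :=
    fun r hr => ((hpd r hr).mul (hηd r)).deriv
  -- Boundary term of the integration by parts when the linearized equation is multiplied by r^N p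
  -- η²; its derivative has integral zero.
  set F : ℝ → ℝ := fun r => r ^ N * w₁ r * p r * η r ^ 2 with hF
  set F' : ℝ → ℝ := fun r => ((N * r ^ (N - 1) * w₁ r + r ^ N * w₂ r) * p r
      + r ^ N * w₁ r * p₁ r) * η r ^ 2 + r ^ N * w₁ r * p r * (2 * η r * deriv η r) with hF'
  have hFd : ∀ r, 0 < r → HasDerivAt F (F' r) r := by
    intro r hr
    have h1 := (((hasDerivAt_pow N r).mul (hw₁d r hr)).mul (hpd r hr)).mul ((hηd r).pow 2)
    refine h1.congr_deriv ?_
    simp [hF']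
  have hF'c : ContinuousOn F' (Ioi 0) := by
    refine ContinuousOn.add (ContinuousOn.mul (ContinuousOn.add (ContinuousOn.mul
      (ContinuousOn.add ?_ (hNc.mul hw₂c)) hp) ((hNc.mul hw₁c).mul hp₁c)) (hηc.pow 2).continuousOn)
      (((hNc.mul hw₁c).mul hp).mul ((continuous_const.mul hηc).mul hη'c).continuousOn)
    exact (continuous_const.mul (continuous_pow (N - 1))).continuousOn.mul hw₁c
  have hF0 : ∀ r, r ∉ Icc a b → F r = 0 := fun r hr => by simp [hF, h0 r hr]
  have hFt : IsHalfLineTest 1 F := isHalfLineTest_one_of_hasDerivAt hFd hF'c ha hab hF0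
  have hzero := hFt.integral_deriv_eq_zero
  -- the quadratic forms
  have hAl : LocallyIntegrableOn (fun r => r ^ N * deriv f (g r)) (Ioi 0) :=
    (hNc.mul hf'gc).locallyIntegrableOn measurableSet_Ioi
  have hBc : ContinuousOn (fun r => r ^ N * (1 / S r ^ 3)) (Ioi 0) :=
    hNc.mul (continuousOn_const.div (hSc.pow 3) fun r _ => (pow_pos (hSpos r) 3).ne')
  have hBl := hBc.locallyIntegrableOn (μ := volume) measurableSet_Ioi
  have hstab := quadratic_le_of_smooth hAl hBl hst hq
  have hψc : ContinuousOn (fun r => r ^ N * (p r ^ 2 / S r ^ 3)) (Ioi 0) :=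
    hNc.mul ((hp.pow 2).div (hSc.pow 3) fun r _ => (pow_pos (hSpos r) 3).ne')
  have i1 : Integrable fun r => r ^ N * deriv f (g r) * (p r * η r) ^ 2 :=
    integrable_mul_of_Icc hAl ha (b := b) (hq.contDiff.continuous.pow 2).continuousOn
      fun r hr => by simp [h0 r hr]
  have i2 : Integrable fun r => r ^ N * (1 / S r ^ 3) * deriv (fun r => p r * η r) r ^ 2 :=
    integrable_mul_of_Icc hBl ha (b := b) ((hq.contDiff.continuous_deriv le_rfl).pow 2).continuousOn
      fun r hr => by
        rw [deriv_eq_zero_of_notMem_Icc (a := a) (b := b) (fun x hx => by simp [h0 x hx]) hr]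
        simp
  have i3 : Integrable fun r => r ^ N * (p r ^ 2 / S r ^ 3) *
      (N * η r ^ 2 / r ^ 2 - deriv η r ^ 2) := by
    refine integrable_mul_of_Icc (hψc.locallyIntegrableOn measurableSet_Ioi) ha (b := b) ?_
      fun r hr => by simp [h0 r hr, hη'0 r hr]
    refine ContinuousOn.sub (ContinuousOn.div ?_ (continuous_pow 2).continuousOn fun r hr =>
      pow_ne_zero 2 (ha.trans_le hr.1).ne') (hη'c.pow 2).continuousOn
    exact (continuous_const.mul (hηc.pow 2)).continuousOn
  have i4 : Integrable (deriv F) :=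
    (hFt.contDiff.continuous_deriv le_rfl).integrable_of_hasCompactSupport
      (hasCompactSupport_of_Icc fun r hr => deriv_eq_zero_of_notMem_Icc hF0 hr)
  -- The exact identity `hid` has N p²/S in the zeroth-order term; replacing it by the smaller N
  -- p²/S³ gives both terms the same weight.
  have hpt : ∀ r, r ^ N * (p r ^ 2 / S r ^ 3) * (N * η r ^ 2 / r ^ 2 - deriv η r ^ 2)
      + (r ^ N * (1 / S r ^ 3) * deriv (fun r => p r * η r) r ^ 2
        - r ^ N * deriv f (g r) * (p r * η r) ^ 2) ≤ deriv F r := by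
    intro r
    by_cases hr : r ∈ Icc a b
    swap
    · have hq0 : deriv (fun r => p r * η r) r = 0 :=
        deriv_eq_zero_of_notMem_Icc (a := a) (b := b) (fun x hx => by simp [h0 x hx]) hr
      rw [deriv_eq_zero_of_notMem_Icc hF0 hr, hq0, h0 r hr, hη'0 r hr]
      simp
    have hr0 : 0 < r := ha.trans_le hr.1
    have hSr := hSpos r
    rw [(hFd r hr0).deriv, hqd r hr0]
    have hpow : N * r ^ (N - 1) = N * r ^ N / r := by
      rcases N with _ | N
      · simp
      · rw [Nat.add_sub_cancel, pow_succ]; field_simp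
    have hid : F' r = r ^ N * (N * (p r ^ 2 / S r) * η r ^ 2 / r ^ 2
        - p r ^ 2 / S r ^ 3 * deriv η r ^ 2)
        + (r ^ N * (1 / S r ^ 3) * (p₁ r * η r + p r * deriv η r) ^ 2
        - r ^ N * deriv f (g r) * (p r * η r) ^ 2) := by
      have e1 : w₁ r = p₁ r / S r ^ 3 := by simp only [hp₁]; field_simp
      have e2 : w r = p r / S r := rfl
      simp only [hF', hpow, hw₂]
      rw [e2, e1]
      field_simp
      ring
    rw [hid]
    have hmono : p r ^ 2 / S r ^ 3 ≤ p r ^ 2 / S r := by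
      have hS1 : 1 ≤ S r := Real.one_le_sqrt.mpr (by nlinarith [sq_nonneg (p r)])
      gcongr
      exact le_self_pow₀ hS1 (by norm_num)
    have h5 : N * (p r ^ 2 / S r ^ 3) * η r ^ 2 / r ^ 2 ≤ N * (p r ^ 2 / S r) * η r ^ 2 / r ^ 2 := by
      gcongr
    have h6 := mul_le_mul_of_nonneg_left h5 (pow_nonneg hr0.le N)
    have h7 : r ^ N * (p r ^ 2 / S r ^ 3) * (N * η r ^ 2 / r ^ 2 - deriv η r ^ 2)
        = r ^ N * (N * (p r ^ 2 / S r ^ 3) * η r ^ 2 / r ^ 2)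
          - r ^ N * (p r ^ 2 / S r ^ 3 * deriv η r ^ 2) := by ring
    rw [h7, mul_sub]
    linarith
  have hint := integral_mono (i3.add (i2.sub i1)) i4 hpt
  have hsplit := integral_add i3 (i2.sub i1)
  have hsplit2 := integral_sub i2 i1
  simp only [Pi.add_apply, Pi.sub_apply] at hint hsplit hsplit2
  linarith

/-! ### Polar coordinates and spherical means. -/

section Polar

variable {E : Type*} [NormedAddCommGroup E] [NormedSpace ℝ E] [FiniteDimensional ℝ E]
  [MeasurableSpace E] [BorelSpace E]

/-- The integral of `h` over the sphere of radius `r`, with respect to the surface measure of the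
unit sphere. -/
def sphereIntegral (μ : Measure E) (h : E → ℝ) (r : ℝ) : ℝ :=
  ∫ θ : Metric.sphere (0 : E) 1, h (r • (θ : E)) ∂μ.toSphere

variable (μ : Measure E) [μ.IsAddHaarMeasure]

theorem integral_volumeIoiPow (N : ℕ) (F : ℝ → ℝ) :
    ∫ r : Ioi (0 : ℝ), F r ∂Measure.volumeIoiPow N = ∫ r in Ioi (0 : ℝ), r ^ N * F r := by
  simp only [Measure.volumeIoiPow, ENNReal.ofReal]
  rw [integral_withDensity_eq_integral_smul,
    integral_subtype_comap measurableSet_Ioi fun a ↦ Real.toNNReal (a ^ N) • F a]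
  · refine setIntegral_congr_fun measurableSet_Ioi fun x hx ↦ ?_
    simp only [NNReal.smul_def, Real.coe_toNNReal _ (pow_nonneg (le_of_lt hx) N), smul_eq_mul]
  · exact (measurable_subtype_coe.pow_const _).real_toNNReal

theorem integrable_volumeIoiPow_iff (N : ℕ) (F : ℝ → ℝ) :
    Integrable (fun r : Ioi (0 : ℝ) => F r) (Measure.volumeIoiPow N) ↔
      IntegrableOn (fun r => r ^ N * F r) (Ioi 0) := by
  rw [integrableOn_iff_comap_subtypeVal measurableSet_Ioi, Measure.volumeIoiPow,
    integrable_withDensity_iff_integrable_smul', integrable_congr]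
  · refine .of_forall ?_
    rintro ⟨x, hx : 0 < x⟩
    simp (disch := positivity) [ENNReal.toReal_ofReal]
  · fun_prop
  · simp

theorem ae_volumeIoiPow_iff (N : ℕ) {P : ℝ → Prop} :
    (∀ᵐ r : Ioi (0 : ℝ) ∂Measure.volumeIoiPow N, P r) ↔ ∀ᵐ r, r ∈ Ioi (0 : ℝ) → P r := by
  rw [← ae_restrict_iff' measurableSet_Ioi, ae_restrict_iff_subtype measurableSet_Ioi,
    Measure.volumeIoiPow, ae_withDensity_iff (by fun_prop)]
  refine eventually_congr (Eventually.of_forall fun r => ?_)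
  have : ENNReal.ofReal (r.1 ^ N) ≠ 0 := by
    simpa using pow_pos r.2 N
  simp [this]

variable [Nontrivial E]

/-- Integration in polar coordinates. -/
theorem integrable_sphereIntegral {F : E → ℝ} (hF : Integrable F μ) :
    IntegrableOn (fun r => r ^ (Module.finrank ℝ E - 1) * sphereIntegral μ F r) (Ioi 0) ∧
    ∫ x, F x ∂μ = ∫ r in Ioi (0 : ℝ), r ^ (Module.finrank ℝ E - 1) * sphereIntegral μ F r := by
  have hmp := μ.measurePreserving_homeomorphUnitSphereProd
  have hemb := (homeomorphUnitSphereProd E).measurableEmbedding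
  set Φ : Metric.sphere (0 : E) 1 × Ioi (0 : ℝ) → ℝ := fun z => F (z.2.1 • (z.1 : E)) with hΦ
  have hcomp : Φ ∘ homeomorphUnitSphereProd E = F ∘ Subtype.val := by
    ext x
    have := homeomorphUnitSphereProd_symm_apply_coe E (homeomorphUnitSphereProd E x)
    rw [Homeomorph.symm_apply_apply] at this
    simp only [hΦ, Function.comp_apply]
    rw [← this]
  have hint : Integrable Φ (μ.toSphere.prod (.volumeIoiPow (Module.finrank ℝ E - 1))) := by
    rw [← hmp.integrable_comp_emb hemb, hcomp,
      ← integrableOn_iff_comap_subtypeVal (measurableSet_singleton _).compl]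
    exact hF.integrableOn
  have hval : ∫ x, F x ∂μ = ∫ z, Φ z ∂(μ.toSphere.prod (.volumeIoiPow (Module.finrank ℝ E - 1))) := by
    rw [← hmp.integral_comp hemb]
    have : ∀ x, Φ (homeomorphUnitSphereProd E x) = F x.1 := fun x => congrFun hcomp x
    simp_rw [this]
    rw [integral_subtype_comap (measurableSet_singleton _).compl, restrict_compl_singleton]
  refine ⟨?_, ?_⟩
  · rw [← integrable_volumeIoiPow_iff]
    exact hint.integral_prod_right
  · rw [hval, integral_prod_symm _ hint, ← integral_volumeIoiPow]
    rfl

theorem ae_norm_of_ae {P : ℝ → Prop} (h : ∀ᵐ r, r ∈ Ioi (0 : ℝ) → P r) : ∀ᵐ x ∂μ, P ‖x‖ := by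
  have hmp := μ.measurePreserving_homeomorphUnitSphereProd
  have h1 : ∀ᵐ z ∂(μ.toSphere.prod (.volumeIoiPow (Module.finrank ℝ E - 1))), P z.2.1 :=
    Measure.quasiMeasurePreserving_snd.ae ((ae_volumeIoiPow_iff _).mpr h)
  have h2 := hmp.quasiMeasurePreserving.ae h1
  rw [← restrict_compl_singleton (μ := μ) 0,
    ae_restrict_iff_subtype (measurableSet_singleton _).compl]
  simpa using h2

/-- Fubini for null sets, transported through the polar homeomorphism. -/
theorem ae_ae_sphere_of_ae {P : E → Prop} (h : ∀ᵐ x ∂μ, P x) :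
    ∀ᵐ r, r ∈ Ioi (0 : ℝ) → ∀ᵐ θ : Metric.sphere (0 : E) 1 ∂μ.toSphere, P (r • (θ : E)) := by
  have hmp := μ.measurePreserving_homeomorphUnitSphereProd
  have hmp' := MeasurePreserving.symm (homeomorphUnitSphereProd E).toMeasurableEquiv hmp
  have h1 : ∀ᵐ x : ({0}ᶜ : Set E) ∂(μ.comap Subtype.val), P x := by
    rw [← ae_restrict_iff_subtype (measurableSet_singleton _).compl, restrict_compl_singleton]
    exact h
  have h2 := hmp'.quasiMeasurePreserving.ae h1
  have h3 : ∀ᵐ z ∂(μ.toSphere.prod (.volumeIoiPow (Module.finrank ℝ E - 1))),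
      P (z.2.1 • (z.1 : E)) := by
    filter_upwards [h2] with z hz
    rw [← homeomorphUnitSphereProd_symm_apply_coe]
    exact hz
  have h4 := Measure.ae_ae_of_ae_prod (Measure.measurePreserving_swap.quasiMeasurePreserving.ae h3)
  exact (ae_volumeIoiPow_iff (Module.finrank ℝ E - 1)).mp h4

theorem locallyIntegrableOn_sphereIntegral {h : E → ℝ} (hh : LocallyIntegrable h μ) :
    LocallyIntegrableOn (sphereIntegral μ h) (Ioi 0) := by
  rw [locallyIntegrableOn_iff isOpen_Ioi.isLocallyClosed]
  intro K hK hKc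
  -- Restriction to the compact shell over `K` makes `h` integrable; on `K` the factor r^(dim - 1)
  -- is then divided out.
  set F : E → ℝ := ({x : E | ‖x‖ ∈ K}).indicator h with hF
  have hmeas : MeasurableSet {x : E | ‖x‖ ∈ K} := hKc.measurableSet.preimage measurable_norm
  have hcpt : IsCompact {x : E | ‖x‖ ∈ K} := by
    obtain ⟨M, hM⟩ := hKc.isBounded.exists_norm_le
    refine (isCompact_closedBall (0 : E) M).of_isClosed_subset
      (hKc.isClosed.preimage continuous_norm) fun x hx => ?_
    simpa using hM _ hx
  have hFi : Integrable F μ := (integrable_indicator_iff hmeas).mpr (hh.integrableOn_isCompact hcpt)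
  have h1 := ((integrable_sphereIntegral μ hFi).1.mono_set hK)
  have h2 : IntegrableOn (fun r => r ^ (Module.finrank ℝ E - 1) * sphereIntegral μ h r) K := by
    refine h1.congr_fun (fun r hr => ?_) hKc.measurableSet
    simp only
    congr 1
    refine integral_congr_ae (Eventually.of_forall fun θ => ?_)
    have hr0 : (0 : ℝ) < r := hK hr
    have : ‖r • (θ : E)‖ ∈ K := by
      rw [norm_smul, norm_eq_of_mem_sphere, mul_one, Real.norm_of_nonneg hr0.le]; exact hr
    exact indicator_of_mem (s := {x : E | ‖x‖ ∈ K}) this h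
  have hc : ContinuousOn (fun r : ℝ => (r ^ (Module.finrank ℝ E - 1))⁻¹) K :=
    (continuous_pow _).continuousOn.inv₀ fun r hr => pow_ne_zero _ (ne_of_gt (hK hr))
  refine (h2.continuousOn_mul hc hKc).congr_fun (fun r hr => ?_) hKc.measurableSet
  have : r ^ (Module.finrank ℝ E - 1) ≠ 0 := pow_ne_zero _ (ne_of_gt (hK hr))
  simp only
  field_simp

theorem integral_mul_radial {h : E → ℝ} (hh : LocallyIntegrable h μ) {φ : ℝ → ℝ}
    (hφ : Continuous φ) {a b : ℝ} (ha : 0 < a) (h0 : ∀ x, x ∉ Icc a b → φ x = 0) :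
    ∫ x, h x * φ ‖x‖ ∂μ = ∫ r, r ^ (Module.finrank ℝ E - 1) * sphereIntegral μ h r * φ r := by
  have hc : HasCompactSupport fun x : E => φ ‖x‖ := by
    refine HasCompactSupport.intro (isCompact_closedBall (0 : E) b) fun x hx => h0 _ fun hx' => hx ?_
    simpa using hx'.2
  have hi : Integrable (fun x => h x * φ ‖x‖) μ := by
    exact hh.integrable_smul_right_of_hasCompactSupport (hφ.comp continuous_norm) hc
  rw [(integrable_sphereIntegral μ hi).2]
  have : ∫ r, r ^ (Module.finrank ℝ E - 1) * sphereIntegral μ h r * φ r =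
      ∫ r in Ioi (0 : ℝ), r ^ (Module.finrank ℝ E - 1) * sphereIntegral μ h r * φ r := by
    refine (setIntegral_eq_integral_of_forall_compl_eq_zero fun r hr => ?_).symm
    rw [h0 r fun hr' => hr (ha.trans_le hr'.1), mul_zero]
  rw [this]
  refine setIntegral_congr_fun measurableSet_Ioi fun r (hr : 0 < r) => ?_
  rw [mul_assoc, sphereIntegral, sphereIntegral, ← integral_mul_const]
  congr 2
  ext θ
  rw [norm_smul, norm_eq_of_mem_sphere, mul_one, Real.norm_of_nonneg hr.le]

/-- On almost every sphere the function is a constant, hence equal to its mean. This replaces the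
arbitrary profile `g` by a locally integrable one. -/
theorem ae_eq_sphereIntegral_of_radial {h : E → ℝ} {g : ℝ → ℝ} (hg : ∀ᵐ x ∂μ, h x = g ‖x‖) :
    ∀ᵐ x ∂μ, h x = (μ.toSphere.real univ)⁻¹ * sphereIntegral μ h ‖x‖ := by
  have h1 : ∀ᵐ r, r ∈ Ioi (0 : ℝ) → g r = (μ.toSphere.real univ)⁻¹ * sphereIntegral μ h r := by
    filter_upwards [ae_ae_sphere_of_ae μ hg] with r hr hr0
    have hr0' : (0 : ℝ) < r := hr0
    have : sphereIntegral μ h r = ∫ _ : Metric.sphere (0 : E) 1, g r ∂μ.toSphere := by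
      refine integral_congr_ae ?_
      filter_upwards [hr hr0] with θ hθ
      rw [hθ, norm_smul, norm_eq_of_mem_sphere, mul_one, Real.norm_of_nonneg hr0'.le]
    rw [this, integral_const, smul_eq_mul, inv_mul_cancel_left₀]
    exact (measureReal_ne_zero_iff (measure_ne_top _ _)).mpr
      (Measure.measure_univ_eq_zero.not.mpr (Measure.toSphere_ne_zero μ))
  filter_upwards [hg, ae_norm_of_ae μ h1] with x hx hx'
  rw [hx, hx']

theorem integral_radial {F : ℝ → ℝ} (hF : ∀ r, r ≤ 0 → F r = 0) :
    ∫ x, F ‖x‖ ∂μ = μ.toSphere.real univ * ∫ r, r ^ (Module.finrank ℝ E - 1) * F r := by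
  rw [integral_fun_norm_addHaar, Measure.toSphere_real_apply_univ, nsmul_eq_mul, smul_eq_mul,
    ← mul_assoc]
  congr 1
  simp only [smul_eq_mul]
  refine setIntegral_eq_integral_of_forall_compl_eq_zero fun r hr => ?_
  rw [hF r (not_lt.mp hr), mul_zero]

end Polar

/-! ### Radial test functions and their gradients. -/

section RadialTest

variable {E : Type*} [NormedAddCommGroup E] [InnerProductSpace ℝ E]

theorem hasFDerivAt_norm_of_ne_zero {x : E} (hx : x ≠ 0) :
    HasFDerivAt (fun y : E => ‖y‖) (‖x‖⁻¹ • innerSL ℝ x) x := by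
  have h0 : 0 < ‖x‖ := norm_pos_iff.mpr hx
  have h1 := ((hasStrictFDerivAt_norm_sq x).hasFDerivAt).sqrt (by positivity)
  have h2 : (fun y : E => √(‖y‖ ^ 2)) = fun y => ‖y‖ := by
    ext y; exact Real.sqrt_sq (norm_nonneg y)
  rw [h2, Real.sqrt_sq h0.le] at h1
  refine h1.congr_fderiv ?_
  ext v
  simp
  field_simp

theorem hasFDerivAt_radial {φ : ℝ → ℝ} {φ' : ℝ} {x : E} (hx : x ≠ 0)
    (hφ : HasDerivAt φ φ' ‖x‖) :
    HasFDerivAt (fun y : E => φ ‖y‖) ((φ' * ‖x‖⁻¹) • innerSL ℝ x) x := by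
  refine (hφ.comp_hasFDerivAt x (hasFDerivAt_norm_of_ne_zero hx)).congr_fderiv ?_
  rw [smul_smul]

theorem eventually_radial_eq_zero {E : Type*} [NormedAddCommGroup E] {φ : ℝ → ℝ} {a b : ℝ} (ha : 0 < a)
    (h0 : ∀ x, x ∉ Icc a b → φ x = 0) : ∀ᶠ y : E in 𝓝 0, φ ‖y‖ = 0 := by
  filter_upwards [Metric.ball_mem_nhds (0 : E) ha] with y hy
  rw [mem_ball_zero_iff] at hy
  exact h0 _ fun h => absurd h.1 (not_le.mpr hy)

theorem IsHalfLineTest.hasFDerivAt_radial {k : WithTop ℕ∞} (hk : k ≠ 0) {φ : ℝ → ℝ}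
    (hφ : IsHalfLineTest k φ) (x : E) :
    HasFDerivAt (fun y : E => φ ‖y‖) ((deriv φ ‖x‖ * ‖x‖⁻¹) • innerSL ℝ x) x := by
  rcases eq_or_ne x 0 with rfl | hx
  · obtain ⟨a, b, ha, hab, h0⟩ := hφ.exists_Icc
    have := (hasFDerivAt_const (𝕜 := ℝ) (0 : ℝ) (0 : E)).congr_of_eventuallyEq
      (eventually_radial_eq_zero ha h0)
    simpa using this
  · exact StableMeanCurvature.hasFDerivAt_radial hx
      ((hφ.contDiff.differentiable hk) _).hasDerivAt

theorem IsHalfLineTest.contDiff_radial {k : WithTop ℕ∞} {φ : ℝ → ℝ} (hφ : IsHalfLineTest k φ) :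
    ContDiff ℝ k (fun y : E => φ ‖y‖) := by
  rw [contDiff_iff_contDiffAt]
  intro x
  rcases eq_or_ne x 0 with rfl | hx
  · obtain ⟨a, b, ha, hab, h0⟩ := hφ.exists_Icc
    exact contDiffAt_const.congr_of_eventuallyEq (eventually_radial_eq_zero ha h0)
  · exact hφ.contDiff.contDiffAt.comp x (contDiffAt_norm ℝ hx)

theorem IsHalfLineTest.hasCompactSupport_radial [FiniteDimensional ℝ E] {k : WithTop ℕ∞} {φ : ℝ → ℝ}
    (hφ : IsHalfLineTest k φ) : HasCompactSupport (fun y : E => φ ‖y‖) := by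
  obtain ⟨a, b, ha, hab, h0⟩ := hφ.exists_Icc
  refine HasCompactSupport.intro (isCompact_closedBall (0 : E) b) fun x hx => h0 _ fun hx' => hx ?_
  simpa using hx'.2

theorem IsHalfLineTest.gradient_radial [CompleteSpace E] {k : WithTop ℕ∞} (hk : k ≠ 0) {φ : ℝ → ℝ}
    (hφ : IsHalfLineTest k φ) (x : E) :
    gradient (fun y : E => φ ‖y‖) x = (deriv φ ‖x‖ * ‖x‖⁻¹) • x := by
  have h : HasGradientAt (fun y : E => φ ‖y‖) ((deriv φ ‖x‖ * ‖x‖⁻¹) • x) x := by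
    rw [hasGradientAt_iff_hasFDerivAt]
    refine (hφ.hasFDerivAt_radial hk x).congr_fderiv ?_
    ext v
    simp
  exact h.gradient

theorem IsHalfLineTest.mul_contDiffOn {k : WithTop ℕ∞} {φ ρ : ℝ → ℝ} (hφ : IsHalfLineTest k φ)
    (hρ : ContDiffOn ℝ k ρ (Ioi 0)) : IsHalfLineTest k (fun r => φ r * ρ r) := by
  obtain ⟨a, b, ha, hab, h0⟩ := hφ.exists_Icc
  refine ⟨contDiff_iff_contDiffAt.mpr fun x => ?_, a, b, ha, hab, fun x hx => by simp [h0 x hx]⟩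
  rcases lt_or_ge 0 x with hx | hx
  · exact hφ.contDiff.contDiffAt.mul (hρ.contDiffAt (Ioi_mem_nhds hx))
  · refine contDiffAt_const (c := (0 : ℝ)).congr_of_eventuallyEq ?_
    filter_upwards [Iio_mem_nhds (lt_of_le_of_lt hx ha)] with y hy
    rw [h0 y fun hy' => absurd hy'.1 (not_le.mpr hy), zero_mul]

end RadialTest

/-! ### Regularity of the radial profile and its gradient. -/

section Sobolev

variable {n : ℕ}

theorem MemSobolevLoc.locallyIntegrable {k : ℕ} {u : EuclideanSpace ℝ (Fin n) → ℝ}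
    (hu : MemSobolevLoc k u) : LocallyIntegrable u volume := by
  cases k with
  | zero => exact hu
  | succ k => exact hu.1

theorem continuous_coord (j : Fin n) : Continuous fun x : EuclideanSpace ℝ (Fin n) => x j :=
  (EuclideanSpace.proj (𝕜 := ℝ) j).continuous

theorem hasFDerivAt_coord (j : Fin n) (x : EuclideanSpace ℝ (Fin n)) :
    HasFDerivAt (fun x : EuclideanSpace ℝ (Fin n) => x j) (EuclideanSpace.proj (𝕜 := ℝ) j) x :=
  (EuclideanSpace.proj (𝕜 := ℝ) j).hasFDerivAt

theorem sum_coord_smul_single (x : EuclideanSpace ℝ (Fin n)) :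
    ∑ j, x j • EuclideanSpace.single j (1 : ℝ) = x := by
  ext i
  simp [Pi.single_apply]

theorem IsTestFunction.integrable_mul {h F : EuclideanSpace ℝ (Fin n) → ℝ}
    (hh : LocallyIntegrable h volume) (hF : IsTestFunction F) :
    Integrable fun x => h x * F x :=
  hh.integrable_smul_right_of_hasCompactSupport hF.1.continuous hF.2

theorem IsTestFunction.coord_mul {F : EuclideanSpace ℝ (Fin n) → ℝ} (hF : IsTestFunction F)
    (j : Fin n) : IsTestFunction fun x => x j * F x :=
  ⟨(EuclideanSpace.proj (𝕜 := ℝ) j).contDiff.mul hF.1, hF.2.mul_left⟩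

/-- Testing weak partial derivatives against the field `x ↦ F x • x`. -/
theorem integral_mul_euler {v : EuclideanSpace ℝ (Fin n) → ℝ}
    {h : Fin n → EuclideanSpace ℝ (Fin n) → ℝ} (hv : LocallyIntegrable v volume)
    (hh : ∀ j, LocallyIntegrable (h j) volume) (hw : ∀ j, IsWeakPartial j v (h j))
    {F : EuclideanSpace ℝ (Fin n) → ℝ} (hF : IsTestFunction F) :
    ∫ x, v x * (n * F x + fderiv ℝ F x x) = -∫ x, (∑ j, h j x * x j) * F x := by
  have hd : ∀ x, HasFDerivAt F (fderiv ℝ F x) x := fun x =>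
    (hF.1.differentiable (by simp) x).hasFDerivAt
  have hder : ∀ j x, fderiv ℝ (fun x => x j * F x) x (EuclideanSpace.single j 1)
      = F x + x j * fderiv ℝ F x (EuclideanSpace.single j 1) := by
    intro j x
    rw [((hasFDerivAt_coord j x).fun_mul (hd x)).fderiv]
    simp
    ring
  have hi1 : ∀ j, Integrable fun x =>
      v x * fderiv ℝ (fun x => x j * F x) x (EuclideanSpace.single j 1) := fun j =>
    hv.integrable_smul_right_of_hasCompactSupport
      (((hF.coord_mul j).1.continuous_fderiv (by simp)).clm_apply continuous_const)
      ((hF.coord_mul j).2.fderiv_apply ℝ _)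
  have hi2 : ∀ j, Integrable fun x => h j x * (x j * F x) := fun j =>
    (hF.coord_mul j).integrable_mul (hh j)
  calc ∫ x, v x * (n * F x + fderiv ℝ F x x)
      = ∫ x, ∑ j, v x * fderiv ℝ (fun x => x j * F x) x (EuclideanSpace.single j 1) := by
        congr 1; ext x
        simp_rw [hder]
        rw [← Finset.mul_sum, Finset.sum_add_distrib]
        have : fderiv ℝ F x x = ∑ j, x j * fderiv ℝ F x (EuclideanSpace.single j 1) := by
          have h1 := congrArg (fderiv ℝ F x) (sum_coord_smul_single x)
          rw [← h1, map_sum]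
          simp
        rw [← this]
        simp
    _ = ∑ j, ∫ x, v x * fderiv ℝ (fun x => x j * F x) x (EuclideanSpace.single j 1) :=
        integral_finsetSum _ fun j _ => hi1 j
    _ = ∑ j, -∫ x, h j x * (x j * F x) := Finset.sum_congr rfl fun j _ => hw j _ (hF.coord_mul j)
    _ = -∫ x, (∑ j, h j x * x j) * F x := by
        rw [Finset.sum_neg_distrib, ← integral_finsetSum _ fun j _ => hi2 j]
        congr 2; ext x
        rw [Finset.sum_mul]
        exact Finset.sum_congr rfl fun j _ => by ring

theorem IsHalfLineTest.isTestFunction_radial {χ : ℝ → ℝ} (hχ : IsHalfLineTest ∞ χ) :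
    IsTestFunction fun x : EuclideanSpace ℝ (Fin n) => χ ‖x‖ :=
  ⟨hχ.contDiff_radial, hχ.hasCompactSupport_radial⟩

theorem IsHalfLineTest.fderiv_radial_self {χ : ℝ → ℝ} (hχ : IsHalfLineTest ∞ χ)
    (x : EuclideanSpace ℝ (Fin n)) :
    fderiv ℝ (fun x : EuclideanSpace ℝ (Fin n) => χ ‖x‖) x x = ‖x‖ * deriv χ ‖x‖ := by
  rw [(hχ.hasFDerivAt_radial (by simp) x).fderiv]
  rcases eq_or_ne x 0 with rfl | hx
  · simp
  · have : ‖x‖ ≠ 0 := norm_ne_zero_iff.mpr hx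
    simp only [smul_apply, innerSL_apply_apply, real_inner_self_eq_norm_sq,
      smul_eq_mul]
    field_simp

theorem integral_mul_euler_radial {v : EuclideanSpace ℝ (Fin n) → ℝ}
    {h : Fin n → EuclideanSpace ℝ (Fin n) → ℝ} (hv : LocallyIntegrable v volume)
    (hh : ∀ j, LocallyIntegrable (h j) volume) (hw : ∀ j, IsWeakPartial j v (h j))
    {χ : ℝ → ℝ} (hχ : IsHalfLineTest ∞ χ) :
    ∫ x, v x * (n * χ ‖x‖ + ‖x‖ * deriv χ ‖x‖) = -∫ x, (∑ j, h j x * x j) * χ ‖x‖ := by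
  rw [← integral_mul_euler hv hh hw hχ.isTestFunction_radial]
  simp_rw [hχ.fderiv_radial_self]

/-- The field is now x_i χ(|x|) x; the extra coordinate has degree one and turns n into n + 1.
Summed over i with v = ∂_i u, this gives the weak derivative of the radial derivative. -/
theorem integral_mul_euler_coord_radial {v : EuclideanSpace ℝ (Fin n) → ℝ}
    {h : Fin n → EuclideanSpace ℝ (Fin n) → ℝ} (hv : LocallyIntegrable v volume)
    (hh : ∀ j, LocallyIntegrable (h j) volume) (hw : ∀ j, IsWeakPartial j v (h j))
    {χ : ℝ → ℝ} (hχ : IsHalfLineTest ∞ χ) (i : Fin n) :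
    ∫ x, (v x * x i) * ((n + 1) * χ ‖x‖ + ‖x‖ * deriv χ ‖x‖)
      = -∫ x, (∑ j, h j x * x j) * x i * χ ‖x‖ := by
  have hF := hχ.isTestFunction_radial (n := n)
  have h1 := integral_mul_euler hv hh hw (hF.coord_mul i)
  have hd : ∀ x : EuclideanSpace ℝ (Fin n), fderiv ℝ (fun x => x i * χ ‖x‖) x x
      = x i * χ ‖x‖ + x i * (‖x‖ * deriv χ ‖x‖) := by
    intro x
    have h2 := (hF.1.differentiable (by simp) x).hasFDerivAt
    rw [((hasFDerivAt_coord i x).fun_mul h2).fderiv]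
    simp only [add_apply, smul_apply, smul_eq_mul,
      hχ.fderiv_radial_self]
    simp
    ring
  simp_rw [hd] at h1
  calc _ = ∫ x, v x * (n * (x i * χ ‖x‖) + (x i * χ ‖x‖ + x i * (‖x‖ * deriv χ ‖x‖))) := by
        congr 1; ext x; ring
    _ = _ := h1
    _ = _ := by congr 2; ext x; ring

theorem nontrivial_euclideanSpace (hn : 0 < n) : Nontrivial (EuclideanSpace ℝ (Fin n)) := by
  have : Nonempty (Fin n) := ⟨⟨0, hn⟩⟩
  infer_instance

/-- A homogeneous first order relation between `V` and `H`, tested against radial functions, says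
that the spherical integral of `V`, suitably normalized, has a weak derivative. -/
theorem weakDeriv_sphereIntegral (hn : 0 < n) {V H : EuclideanSpace ℝ (Fin n) → ℝ}
    (hV : LocallyIntegrable V volume) (hH : LocallyIntegrable H volume) (m : ℕ)
    (hVH : ∀ χ, IsHalfLineTest ∞ χ →
      ∫ x, V x * ((n + m) * χ ‖x‖ + ‖x‖ * deriv χ ‖x‖) = -∫ x, H x * χ ‖x‖)
    {φ : ℝ → ℝ} (hφ : IsHalfLineTest ∞ φ) :
    ∫ r, sphereIntegral volume V r / r ^ m * deriv φ r
      = -∫ r, sphereIntegral volume H r / r ^ (m + 1) * φ r := by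
  have := nontrivial_euclideanSpace hn
  obtain ⟨a, b, ha, hab, h0⟩ := hφ.exists_Icc
  -- Integrating factor: for χ = φ r^(-n-m) one has (n + m) χ + r χ' = r^(1-n-m) φ', and the polar
  -- Jacobian r^(n-1) leaves φ'/r^m.
  have hρ : ContDiffOn ℝ ∞ (fun r : ℝ => (r ^ (n + m))⁻¹) (Ioi 0) :=
    (contDiff_id.pow (n + m)).contDiffOn.inv fun r hr => pow_ne_zero _ (ne_of_gt hr)
  have hχ := hφ.mul_contDiffOn hρ
  set χ : ℝ → ℝ := fun r => φ r * (r ^ (n + m))⁻¹ with hχdef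
  have hχ0 : ∀ r, r ∉ Icc a b → χ r = 0 := fun r hr => by simp [hχdef, h0 r hr]
  have hχ'0 : ∀ r, r ∉ Icc a b → deriv χ r = 0 := fun r hr => deriv_eq_zero_of_notMem_Icc hχ0 hr
  have hφ'0 : ∀ r, r ∉ Icc a b → deriv φ r = 0 := fun r hr => deriv_eq_zero_of_notMem_Icc h0 hr
  have hχ'c : Continuous (deriv χ) := hχ.contDiff.continuous_deriv (by simp)
  have h1 := hVH χ hχ
  rw [integral_mul_radial volume hV (φ := fun r => (n + m) * χ r + r * deriv χ r)
      ((continuous_const.mul hχ.contDiff.continuous).add (continuous_id.mul hχ'c)) ha (b := b)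
      (fun r hr => by simp [hχ0 r hr, hχ'0 r hr]),
    integral_mul_radial volume hH (φ := χ) hχ.contDiff.continuous ha hχ0,
    finrank_euclideanSpace_fin] at h1
  obtain ⟨N, rfl⟩ : ∃ N, n = N + 1 := ⟨n - 1, by omega⟩
  rw [Nat.add_sub_cancel] at h1
  calc _ = _ := ?_
    _ = _ := h1
    _ = _ := ?_
  · congr 1; ext r
    by_cases hr : r ∈ Icc a b
    swap
    · simp [hχ0 r hr, hχ'0 r hr, hφ'0 r hr]
    have hr0 : r ≠ 0 := (ha.trans_le hr.1).ne'
    have hd : HasDerivAt χ (deriv φ r * (r ^ (N + 1 + m))⁻¹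
        + φ r * (-(((N + 1 + m : ℕ) : ℝ) * r ^ (N + 1 + m - 1)) / (r ^ (N + 1 + m)) ^ 2)) r :=
      ((hφ.contDiff.differentiable (by simp) r).hasDerivAt).mul
        ((hasDerivAt_pow (N + 1 + m) r).inv (pow_ne_zero _ hr0))
    have e : N + 1 + m - 1 = N + m := by omega
    have e2 : r ^ (N + 1 + m) = r ^ N * r ^ m * r := by ring
    rw [hd.deriv, e, hχdef]
    simp only
    rw [e2, pow_add]
    push_cast
    field_simp
    ring
  · congr 2; ext r
    by_cases hr : r ∈ Icc a b
    swap
    · simp [hχ0 r hr, h0 r hr]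
    have hr0 : r ≠ 0 := (ha.trans_le hr.1).ne'
    rw [hχdef]
    simp only
    have e2 : r ^ (N + 1 + m) = r ^ N * r ^ m * r := by ring
    rw [e2, pow_succ]
    field_simp

theorem locallyIntegrableOn_div_pow {S : ℝ → ℝ} (hS : LocallyIntegrableOn S (Ioi 0)) (m : ℕ) :
    LocallyIntegrableOn (fun r => S r / r ^ m) (Ioi 0) := by
  rw [locallyIntegrableOn_iff isOpen_Ioi.isLocallyClosed]
  intro K hK hKc
  simp_rw [div_eq_mul_inv]
  exact (hS.integrableOn_compact_subset hK hKc).mul_continuousOn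
    ((continuous_pow m).continuousOn.inv₀ fun r hr => pow_ne_zero m (ne_of_gt (hK hr))) hKc

theorem locallyIntegrable_sum {ι : Type*} (s : Finset ι) {F : ι → EuclideanSpace ℝ (Fin n) → ℝ}
    (hF : ∀ i, LocallyIntegrable (F i) volume) :
    LocallyIntegrable (fun x => ∑ i ∈ s, F i x) volume := fun x => by
  classical
  induction s using Finset.induction_on with
  | empty => simpa using (locallyIntegrable_zero (X := EuclideanSpace ℝ (Fin n)) (ε'' := ℝ) x)
  | insert i s hi ih =>
    simp_rw [Finset.sum_insert hi]
    exact (hF i x).add ih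

/-- A radial function in `W^{2,1}_loc` is given, away from the origin, by a `C^1` profile. -/
theorem exists_radial_profile (hn : 0 < n) {u : EuclideanSpace ℝ (Fin n) → ℝ} {k : ℕ}
    (hu : MemSobolevLoc (k + 2) u) (hrad : IsRadial u) :
    ∃ g p : ℝ → ℝ, (∀ r, 0 < r → HasDerivAt g (p r) r) ∧ ContinuousOn p (Ioi 0) ∧
      ∀ᵐ x, u x = g ‖x‖ := by
  have := nontrivial_euclideanSpace hn
  obtain ⟨hu0, hu1⟩ := hu
  choose v hv hv1 using hu1
  have hvl : ∀ i, LocallyIntegrable (v i) volume := fun i => (hv1 i).locallyIntegrable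
  choose h hh hh1 using fun i => (hv1 i).2
  have hhl : ∀ i j, LocallyIntegrable (h i j) volume := fun i j => (hh1 i j).locallyIntegrable
  set V : EuclideanSpace ℝ (Fin n) → ℝ := fun x => ∑ j, v j x * x j with hV
  set H : EuclideanSpace ℝ (Fin n) → ℝ := fun x => ∑ i, (∑ j, h i j x * x j) * x i with hH
  have hVl : LocallyIntegrable V volume := locallyIntegrable_sum _ fun j =>
    (hvl j).mul_continuous (continuous_coord j)
  have hHi : ∀ i, LocallyIntegrable (fun x => (∑ j, h i j x * x j) * x i) volume := fun i =>
    (locallyIntegrable_sum _ fun j => (hhl i j).mul_continuous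
      (continuous_coord j)).mul_continuous (continuous_coord i)
  have hHl : LocallyIntegrable H volume := locallyIntegrable_sum _ hHi
  have hSu := locallyIntegrableOn_sphereIntegral volume hu0
  have hSV := locallyIntegrableOn_sphereIntegral volume hVl
  have hSH := locallyIntegrableOn_sphereIntegral volume hHl
  -- the radial derivative has a continuous representative
  obtain ⟨hc, c, hcae⟩ := ae_eq_primitive_of_weakDeriv (locallyIntegrableOn_div_pow hSV 1)
    (locallyIntegrableOn_div_pow hSH (1 + 1)) fun φ hφ =>
      weakDeriv_sphereIntegral hn hVl hHl 1 (fun χ hχ => by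
        have hF := hχ.isTestFunction_radial (n := n)
        have i1 : ∀ i, Integrable fun x =>
            (v i x * x i) * ((n + 1) * χ ‖x‖ + ‖x‖ * deriv χ ‖x‖) := fun i => by
          refine ((hvl i).mul_continuous
            (continuous_coord i)).integrable_smul_right_of_hasCompactSupport ?_ ?_
          · exact (continuous_const.mul hF.1.continuous).add (continuous_norm.mul
              ((hχ.contDiff.continuous_deriv (by simp)).comp continuous_norm))
          · obtain ⟨a, b, ha, hab, h0⟩ := hχ.exists_Icc
            refine HasCompactSupport.intro (isCompact_closedBall 0 b) fun x hx => ?_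
            have hx' : ‖x‖ ∉ Icc a b := fun hx' => hx (by simpa using hx'.2)
            simp [h0 _ hx', deriv_eq_zero_of_notMem_Icc h0 hx']
        have i2 : ∀ i, Integrable fun x => (∑ j, h i j x * x j) * x i * χ ‖x‖ := fun i =>
          hF.integrable_mul (hHi i)
        simp only [hV, hH, Finset.sum_mul _ _ (_ + _), Finset.sum_mul _ _ (χ _), Nat.cast_one]
        rw [integral_finsetSum _ fun i _ => i1 i, integral_finsetSum _ fun i _ => i2 i,
          ← Finset.sum_neg_distrib]
        exact Finset.sum_congr rfl fun i _ =>
          integral_mul_euler_coord_radial (hvl i) (hhl i) (hh i) hχ i) hφ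
  set p₀ : ℝ → ℝ := fun r => c + ∫ t in (1 : ℝ)..r, sphereIntegral volume H t / t ^ (1 + 1)
  have hp₀c : ContinuousOn p₀ (Ioi 0) := continuousOn_const.add hc
  -- Second application, with m = 0: the spherical integral of u has weak derivative S_V/r, which is
  -- replaced by its continuous representative `p₀`.
  obtain ⟨-, d, hdae⟩ := ae_eq_primitive_of_weakDeriv (locallyIntegrableOn_div_pow hSu 0)
    (hp₀c.locallyIntegrableOn measurableSet_Ioi) fun φ hφ => by
      rw [weakDeriv_sphereIntegral hn hu0 hVl 0 (fun χ hχ => by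
        simpa using integral_mul_euler_radial hu0 hvl hv hχ) hφ]
      congr 1
      refine integral_congr_ae ?_
      obtain ⟨a, b, ha, hab, h0⟩ := hφ.exists_Icc
      filter_upwards [hcae] with r hr
      by_cases hr' : r ∈ Icc a b
      · exact congrArg (· * φ r) (hr (ha.trans_le hr'.1))
      · simp [h0 r hr']
  obtain ⟨g₀, hg₀⟩ := hrad
  set σ := (volume : Measure (EuclideanSpace ℝ (Fin n))).toSphere.real univ
  refine ⟨fun r => σ⁻¹ * (d + ∫ t in (1 : ℝ)..r, p₀ t), fun r => σ⁻¹ * p₀ r, fun r hr =>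
    (hasDerivAt_primitive_of_continuousOn hp₀c hr d).const_mul _, continuousOn_const.mul hp₀c, ?_⟩
  filter_upwards [ae_eq_sphereIntegral_of_radial volume hg₀, ae_norm_of_ae volume hdae]
    with x h1 h2
  rw [h1, ← h2]
  simp [σ]

theorem integrable_mul_of_tsupport_subset {F ψ : EuclideanSpace ℝ (Fin n) → ℝ}
    {U : Set (EuclideanSpace ℝ (Fin n))} (hF : ContinuousOn F U) (hψ : Continuous ψ)
    (hc : HasCompactSupport ψ) (hs : tsupport ψ ⊆ U) : Integrable fun x => F x * ψ x := by
  have h1 : IntegrableOn (fun x => F x * ψ x) (tsupport ψ) :=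
    ((hF.mono hs).mul hψ.continuousOn).integrableOn_compact hc
  refine (integrableOn_iff_integrable_of_support_subset fun x hx => ?_).mp h1
  by_contra hx'
  exact hx (by simp [image_eq_zero_of_notMem_tsupport hx'])

/-- The weak gradient of a radial function with a `C^1` profile. -/
theorem ae_eq_radial_gradient (hn : 0 < n) {u : EuclideanSpace ℝ (Fin n) → ℝ}
    {G : EuclideanSpace ℝ (Fin n) → EuclideanSpace ℝ (Fin n)} (hG : IsWeakGradient u G)
    {g p : ℝ → ℝ} (hg : ∀ r, 0 < r → HasDerivAt g (p r) r) (hp : ContinuousOn p (Ioi 0))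
    (hu : ∀ᵐ x, u x = g ‖x‖) : ∀ᵐ x, G x = (p ‖x‖ * ‖x‖⁻¹) • x := by
  have := nontrivial_euclideanSpace hn
  have hU : IsOpen ({0}ᶜ : Set (EuclideanSpace ℝ (Fin n))) := isOpen_compl_singleton
  have hmaps : MapsTo (fun x : EuclideanSpace ℝ (Fin n) => ‖x‖) {0}ᶜ (Ioi 0) := fun x hx =>
    norm_pos_iff.mpr hx
  have hgc : ContinuousOn g (Ioi 0) := fun r hr => (hg r hr).continuousAt.continuousWithinAt
  have hgn : ContinuousOn (fun x : EuclideanSpace ℝ (Fin n) => g ‖x‖) {0}ᶜ :=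
    hgc.comp continuous_norm.continuousOn hmaps
  have hpn : ∀ i, ContinuousOn (fun x : EuclideanSpace ℝ (Fin n) => p ‖x‖ * ‖x‖⁻¹ * x i) {0}ᶜ :=
    fun i => ((hp.comp continuous_norm.continuousOn hmaps).mul
      (continuous_norm.continuousOn.inv₀ fun x hx => norm_ne_zero_iff.mpr hx)).mul
      (continuous_coord i).continuousOn
  have hgd : ∀ x : EuclideanSpace ℝ (Fin n), x ≠ 0 →
      HasFDerivAt (fun x : EuclideanSpace ℝ (Fin n) => g ‖x‖) ((p ‖x‖ * ‖x‖⁻¹) • innerSL ℝ x) x :=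
    fun x hx => hasFDerivAt_radial hx (hg _ (norm_pos_iff.mpr hx))
  have hGi : ∀ i, LocallyIntegrable (fun x => G x i) volume := fun i =>
    hG.locallyIntegrable_grad.mono
      ((continuous_coord i).comp_aestronglyMeasurable hG.locallyIntegrable_grad.aestronglyMeasurable)
      (Eventually.of_forall fun x => PiLp.norm_apply_le (G x) i)
  have key : ∀ i, ∀ᵐ x, x ∈ ({0}ᶜ : Set (EuclideanSpace ℝ (Fin n))) →
      G x i - p ‖x‖ * ‖x‖⁻¹ * x i = 0 := by
    intro i
    refine hU.ae_eq_zero_of_integral_contDiff_smul_eq_zero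
      (((hGi i).locallyIntegrableOn _).sub ((hpn i).locallyIntegrableOn hU.measurableSet)) ?_
    intro ψ hψ hψc hψs
    have hψd : Continuous fun x => fderiv ℝ ψ x (EuclideanSpace.single i 1) :=
      (hψ.continuous_fderiv (by simp)).clm_apply continuous_const
    have hψdc : HasCompactSupport fun x => fderiv ℝ ψ x (EuclideanSpace.single i 1) :=
      hψc.fderiv_apply ℝ _
    have hψds : tsupport (fun x => fderiv ℝ ψ x (EuclideanSpace.single i 1)) ⊆ {0}ᶜ :=
      (tsupport_fderiv_apply_subset ℝ _).trans hψs
    -- The support of `ψ` avoids the origin, so there the classical gradient is available; outside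
    -- the support both sides vanish.
    have hfe : (fun x => fderiv ℝ (fun x : EuclideanSpace ℝ (Fin n) => g ‖x‖) x
        (EuclideanSpace.single i 1) * ψ x) = fun x => p ‖x‖ * ‖x‖⁻¹ * x i * ψ x := by
      ext x
      by_cases hx : x ∈ tsupport ψ
      · rw [(hgd x (hψs hx)).fderiv]
        simp [EuclideanSpace.inner_single_right]
      · simp [image_eq_zero_of_notMem_tsupport hx]
    have i1 : Integrable fun x => p ‖x‖ * ‖x‖⁻¹ * x i * ψ x :=
      integrable_mul_of_tsupport_subset (hpn i) hψ.continuous hψc hψs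
    have i2 : Integrable fun x => G x i * ψ x :=
      IsTestFunction.integrable_mul (hGi i) ⟨hψ, hψc⟩
    have hparts := integral_mul_fderiv_eq_neg_fderiv_mul_of_integrable (𝕜 := ℝ) (μ := volume)
      (f := fun x : EuclideanSpace ℝ (Fin n) => g ‖x‖) (g := ψ) (v := EuclideanSpace.single i 1)
      (hfe ▸ i1) (integrable_mul_of_tsupport_subset hgn hψd hψdc hψds)
      (integrable_mul_of_tsupport_subset hgn hψ.continuous hψc hψs)
      (fun x hx => (hgd x (hψs hx)).differentiableAt)
      (fun x _ => hψ.differentiable (by simp) x)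
    rw [hfe] at hparts
    have hweak := hG.weakPartial i ψ ⟨hψ, hψc⟩
    have hcongr : ∫ x, u x * fderiv ℝ ψ x (EuclideanSpace.single i 1)
        = ∫ x, g ‖x‖ * fderiv ℝ ψ x (EuclideanSpace.single i 1) := by
      refine integral_congr_ae ?_
      filter_upwards [hu] with x hx
      rw [hx]
    have : ∫ x, ψ x • (G x i - p ‖x‖ * ‖x‖⁻¹ * x i)
        = (∫ x, G x i * ψ x) - ∫ x, p ‖x‖ * ‖x‖⁻¹ * x i * ψ x := by
      rw [← integral_sub i2 i1]
      congr 1; ext x; simp only [smul_eq_mul]; ring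
    rw [this]
    linarith
  filter_upwards [ae_all_iff.mpr key, Measure.ae_ne volume (0 : EuclideanSpace ℝ (Fin n))]
    with x hx hx0
  ext i
  have := hx i hx0
  simp only [PiLp.smul_apply, smul_eq_mul]
  linarith

end Sobolev

/-! ### Pointwise bounds on the weight. -/

theorem rpow_three_halves (t : ℝ) : (1 + t ^ 2) ^ (3 / 2 : ℝ) = √(1 + t ^ 2) ^ 3 := by
  rw [Real.sqrt_eq_rpow, ← Real.rpow_mul_natCast (by positivity)]
  norm_num

/-- This bound and the next two, by t² and by 1/t, serve respectively the low-dimensional case, the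
small-gradient case and the large-gradient case of the Liouville statement. -/
theorem sq_div_sqrt_pow_le_one (t : ℝ) : t ^ 2 / √(1 + t ^ 2) ^ 3 ≤ 1 := by
  have hS1 : 1 ≤ √(1 + t ^ 2) := Real.one_le_sqrt.mpr (by nlinarith [sq_nonneg t])
  have hS2 : √(1 + t ^ 2) ^ 2 = 1 + t ^ 2 := Real.sq_sqrt (by positivity)
  rw [div_le_one (by positivity)]
  calc t ^ 2 ≤ √(1 + t ^ 2) ^ 2 := by rw [hS2]; linarith
    _ ≤ √(1 + t ^ 2) ^ 3 := pow_le_pow_right₀ hS1 (by norm_num)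

theorem sq_div_sqrt_pow_le_sq (t : ℝ) : t ^ 2 / √(1 + t ^ 2) ^ 3 ≤ t ^ 2 :=
  div_le_self (sq_nonneg t) (one_le_pow₀ (Real.one_le_sqrt.mpr (by nlinarith [sq_nonneg t])))

theorem sq_div_sqrt_pow_le_inv {t : ℝ} (ht : 0 < t) : t ^ 2 / √(1 + t ^ 2) ^ 3 ≤ t⁻¹ := by
  have hS : t ≤ √(1 + t ^ 2) := Real.le_sqrt_of_sq_le (by linarith)
  calc t ^ 2 / √(1 + t ^ 2) ^ 3 ≤ t ^ 2 / t ^ 3 := by gcongr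
    _ = t⁻¹ := by field_simp

theorem setAverage_le_of_ae_le {α : Type*} [MeasurableSpace α] {μ : Measure α} {A : Set α}
    (hA : MeasurableSet A) (hfin : μ A ≠ ⊤) {h : α → ℝ} {M : ℝ} (hM : 0 ≤ M) (h0 : ∀ x, 0 ≤ h x)
    (hle : ∀ᵐ x ∂μ, x ∈ A → h x ≤ M) : ⨍ x in A, h x ∂μ ≤ M := by
  rw [setAverage_eq, smul_eq_mul]
  have h1 : ∫ x in A, h x ∂μ ≤ ∫ _ in A, M ∂μ :=
    integral_mono_of_nonneg (Eventually.of_forall h0) (integrableOn_const hfin)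
      ((ae_restrict_iff' hA).mpr hle)
  rw [setIntegral_const, smul_eq_mul] at h1
  rcases eq_or_ne (μ.real A) 0 with h2 | h2
  · simpa [h2] using hM
  · have h3 : 0 < μ.real A := lt_of_le_of_ne measureReal_nonneg h2.symm
    rw [inv_mul_le_iff₀ h3]
    exact h1

/-! ### Reduction to one variable and growth on annuli. -/

section Growth

variable {n : ℕ}

theorem norm_radial_smul {x : EuclideanSpace ℝ (Fin n)} (hx : x ≠ 0) (t : ℝ) :
    ‖(t * ‖x‖⁻¹) • x‖ ^ 2 = t ^ 2 := by
  have : ‖x‖ ≠ 0 := norm_ne_zero_iff.mpr hx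
  rw [norm_smul, mul_pow, Real.norm_eq_abs, sq_abs]
  field_simp

theorem inner_radial_smul {x : EuclideanSpace ℝ (Fin n)} (hx : x ≠ 0) (s t : ℝ) :
    inner ℝ ((s * ‖x‖⁻¹) • x) ((t * ‖x‖⁻¹) • x) = s * t := by
  have : ‖x‖ ≠ 0 := norm_ne_zero_iff.mpr hx
  rw [real_inner_smul_left, real_inner_smul_right, real_inner_self_eq_norm_sq]
  field_simp

theorem sphere_measure_pos (hn : 0 < n) :
    0 < (volume : Measure (EuclideanSpace ℝ (Fin n))).toSphere.real univ := by
  have := nontrivial_euclideanSpace hn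
  refine lt_of_le_of_ne measureReal_nonneg (Ne.symm ?_)
  exact (measureReal_ne_zero_iff (measure_ne_top _ _)).mpr
    (Measure.measure_univ_eq_zero.not.mpr (Measure.toSphere_ne_zero volume))

variable {f : ℝ → ℝ} {u : EuclideanSpace ℝ (Fin n) → ℝ}
  {G : EuclideanSpace ℝ (Fin n) → EuclideanSpace ℝ (Fin n)} {g p : ℝ → ℝ}

/-- The weak equation for radial test functions, in the radial variable. -/
theorem IsWeakSolution.radial_equation (hn : 0 < n) (hsol : IsWeakSolution f u G)
    (hu : ∀ᵐ x, u x = g ‖x‖) (hG : ∀ᵐ x, G x = (p ‖x‖ * ‖x‖⁻¹) • x) {φ : ℝ → ℝ}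
    (hφ : IsHalfLineTest ∞ φ) :
    ∫ r, r ^ (n - 1) * (p r / √(1 + p r ^ 2)) * deriv φ r
      = ∫ r, r ^ (n - 1) * f (g r) * φ r := by
  have := nontrivial_euclideanSpace hn
  obtain ⟨a, b, ha, hab, h0⟩ := hφ.exists_Icc
  have hneg : ∀ r, r ≤ 0 → r ∉ Icc a b := fun r hr h => absurd (ha.trans_le h.1) (not_lt.mpr hr)
  have h1 := hsol.equation _ hφ.isTestFunction_radial
  have e1 : ∫ x, inner ℝ (G x) (gradient (fun y : EuclideanSpace ℝ (Fin n) => φ ‖y‖) x)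
        / √(1 + ‖G x‖ ^ 2)
      = ∫ x : EuclideanSpace ℝ (Fin n), (fun r => p r / √(1 + p r ^ 2) * deriv φ r) ‖x‖ := by
    refine integral_congr_ae ?_
    filter_upwards [hG, Measure.ae_ne volume (0 : EuclideanSpace ℝ (Fin n))] with x hx hx0
    rw [hφ.gradient_radial (by simp), hx, norm_radial_smul hx0, inner_radial_smul hx0]
    ring
  have e2 : ∫ x, f (u x) * φ ‖x‖
      = ∫ x : EuclideanSpace ℝ (Fin n), (fun r => f (g r) * φ r) ‖x‖ := by
    refine integral_congr_ae ?_
    filter_upwards [hu] with x hx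
    rw [hx]
  rw [e1, e2, integral_radial volume (F := fun r => p r / √(1 + p r ^ 2) * deriv φ r) fun r hr => by
      simp [deriv_eq_zero_of_notMem_Icc h0 (hneg r hr)],
    integral_radial volume (F := fun r => f (g r) * φ r) fun r hr => by simp [h0 r (hneg r hr)],
    finrank_euclideanSpace_fin] at h1
  simpa only [mul_assoc] using mul_left_cancel₀ (sphere_measure_pos hn).ne' h1

/-- The stability inequality for radial test functions, in the radial variable. -/
theorem IsStableSolution.radial_stable (hn : 0 < n) (hst : IsStableSolution f u G)
    (hu : ∀ᵐ x, u x = g ‖x‖) (hG : ∀ᵐ x, G x = (p ‖x‖ * ‖x‖⁻¹) • x) {q : ℝ → ℝ}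
    (hq : IsHalfLineTest ∞ q) :
    ∫ r, r ^ (n - 1) * deriv f (g r) * q r ^ 2
      ≤ ∫ r, r ^ (n - 1) * (1 / √(1 + p r ^ 2) ^ 3) * deriv q r ^ 2 := by
  have := nontrivial_euclideanSpace hn
  obtain ⟨a, b, ha, hab, h0⟩ := hq.exists_Icc
  have hneg : ∀ r, r ≤ 0 → r ∉ Icc a b := fun r hr h => absurd (ha.trans_le h.1) (not_lt.mpr hr)
  have h1 := hst.stable _ hq.isTestFunction_radial
  have e1 : ∫ x, (‖gradient (fun y : EuclideanSpace ℝ (Fin n) => q ‖y‖) x‖ ^ 2 / √(1 + ‖G x‖ ^ 2)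
        - inner ℝ (G x) (gradient (fun y : EuclideanSpace ℝ (Fin n) => q ‖y‖) x) ^ 2
          / (1 + ‖G x‖ ^ 2) ^ (3 / 2 : ℝ))
      = ∫ x : EuclideanSpace ℝ (Fin n),
          (fun r => 1 / √(1 + p r ^ 2) ^ 3 * deriv q r ^ 2) ‖x‖ := by
    refine integral_congr_ae ?_
    filter_upwards [hG, Measure.ae_ne volume (0 : EuclideanSpace ℝ (Fin n))] with x hx hx0
    -- The gradients of u and of the test function are parallel, so the form collapses by 1/S -
    -- p²/S³ = 1/S³.
    rw [hq.gradient_radial (by simp), hx, norm_radial_smul hx0, norm_radial_smul hx0,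
      inner_radial_smul hx0, rpow_three_halves]
    have hS : 0 < √(1 + p ‖x‖ ^ 2) := Real.sqrt_pos.mpr (by positivity)
    have hS2 : √(1 + p ‖x‖ ^ 2) ^ 2 = 1 + p ‖x‖ ^ 2 := Real.sq_sqrt (by positivity)
    field_simp
    rw [hS2]
    ring
  have e2 : ∫ x, deriv f (u x) * q ‖x‖ ^ 2
      = ∫ x : EuclideanSpace ℝ (Fin n), (fun r => deriv f (g r) * q r ^ 2) ‖x‖ := by
    refine integral_congr_ae ?_
    filter_upwards [hu] with x hx
    rw [hx]
  rw [e1, e2, integral_radial volume (F := fun r => deriv f (g r) * q r ^ 2) fun r hr => by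
      simp [h0 r (hneg r hr)],
    integral_radial volume (F := fun r => 1 / √(1 + p r ^ 2) ^ 3 * deriv q r ^ 2) fun r hr => by
      simp [deriv_eq_zero_of_notMem_Icc h0 (hneg r hr)], finrank_euclideanSpace_fin] at h1
  simpa only [mul_assoc] using le_of_mul_le_mul_left h1 (sphere_measure_pos hn)

/-- A nonconstant radial profile has a nonzero derivative somewhere. -/
theorem exists_deriv_ne_zero_of_not_isConstant (hn : 0 < n)
    (hg : ∀ r, 0 < r → HasDerivAt g (p r) r) (hu : ∀ᵐ x, u x = g ‖x‖) (hconst : ¬ IsConstant u) :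
    ∃ r, 0 < r ∧ p r ≠ 0 := by
  have := nontrivial_euclideanSpace hn
  by_contra! hp
  refine hconst ⟨g 1, ?_⟩
  have hc : ∀ r ∈ Ioi (0 : ℝ), g r = g 1 := by
    intro r hr
    refine isOpen_Ioi.is_const_of_deriv_eq_zero isPreconnected_Ioi
      (fun x hx => (hg x hx).differentiableAt.differentiableWithinAt)
      (fun x hx => ?_) hr (mem_Ioi.mpr one_pos)
    rw [(hg x hx).deriv, hp x hx]; rfl
  filter_upwards [hu, Measure.ae_ne volume (0 : EuclideanSpace ℝ (Fin n))] with x hx hx0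
  rw [hx, hc _ (norm_pos_iff.mpr hx0)]

/-- The lower bound on dyadic annuli for nonconstant radial stable solutions. -/
theorem IsStableSolution.exists_average_lower_bound (hn : 2 ≤ n) (hf : ContDiff ℝ 1 f)
    (hst : IsStableSolution f u G) {k : ℕ} (hu : MemSobolevLoc (k + 2) u)
    (hG : IsWeakGradient u G) (hrad : IsRadial u) (hconst : ¬ IsConstant u) :
    ∃ c : ℝ, 0 < c ∧ ∃ R₀ : ℝ, 2 < R₀ ∧ ∀ R : ℝ, R₀ ≤ R →
      c * R ^ (-(n : ℝ) + 2 * √((n : ℝ) - 1) + 2) ≤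
        ⨍ x in Metric.ball (0 : EuclideanSpace ℝ (Fin n)) (2 * R) \ Metric.ball 0 R,
          ‖G x‖ ^ 2 / (1 + ‖G x‖ ^ 2) ^ (3 / 2 : ℝ) := by
  have hn0 : 0 < n := by omega
  have := nontrivial_euclideanSpace hn0
  obtain ⟨g, p, hg, hp, hug⟩ := exists_radial_profile hn0 hu hrad
  have hGp := ae_eq_radial_gradient hn0 hG hg hp hug
  obtain ⟨r₁, hr₁, hpr₁⟩ := exists_deriv_ne_zero_of_not_isConstant hn0 hg hug hconst
  set s := √((n : ℝ) - 1) with hs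
  have hn1 : (1 : ℝ) ≤ (n : ℝ) - 1 := by
    have : (2 : ℝ) ≤ n := by exact_mod_cast hn
    linarith
  have hs1 : 1 ≤ s := Real.one_le_sqrt.mpr hn1
  have hs2 : s ^ 2 = ((n - 1 : ℕ) : ℝ) := by
    rw [hs, Real.sq_sqrt (by linarith), Nat.cast_sub (by omega), Nat.cast_one]
  set ψ : ℝ → ℝ := fun r => p r ^ 2 / √(1 + p r ^ 2) ^ 3 with hψ
  have hSpos : ∀ r, 0 < √(1 + p r ^ 2) := fun r => Real.sqrt_pos.mpr (by positivity)
  have hψc : ContinuousOn ψ (Ioi 0) :=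
    (hp.pow 2).div ((continuousOn_const.add (hp.pow 2)).sqrt.pow 3)
      fun r _ => (pow_pos (hSpos r) 3).ne'
  obtain ⟨c, hc, R₀, hR₀, hgrow⟩ := exists_growth_of_hardy (N := n - 1) (by omega) hs1 hψc
    (fun r => by simp only [hψ]; positivity) (fun r => sq_div_sqrt_pow_le_one _)
    (fun η hη => by
      rw [hs2]
      exact hardy_of_radial_stable hf hg hp
        (fun φ hφ => hst.weakSolution.radial_equation hn0 hug hGp hφ)
        (fun q hq => hst.radial_stable hn0 hug hGp hq) hη)
    hr₁ (by have := hSpos r₁; simp only [hψ]; positivity)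
  set σ := (volume : Measure (EuclideanSpace ℝ (Fin n))).toSphere.real univ
  have hσ : 0 < σ := sphere_measure_pos hn0
  set κ := (volume : Measure (EuclideanSpace ℝ (Fin n))).real (Metric.ball 0 1)
  have hκ : 0 < κ := ENNReal.toReal_pos (Metric.measure_ball_pos volume _ one_pos).ne' measure_ball_lt_top.ne
  refine ⟨σ * c / (2 ^ n * κ), by positivity, R₀, hR₀, fun R hR => ?_⟩
  have hR0 : 0 < R := by linarith
  set A := Metric.ball (0 : EuclideanSpace ℝ (Fin n)) (2 * R) \ Metric.ball 0 R with hA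
  have hAm : MeasurableSet A := measurableSet_ball.diff measurableSet_ball
  have hAmem : ∀ x, x ∈ A ↔ ‖x‖ ∈ Ico R (2 * R) := fun x => by
    simp [hA, and_comm]
  have hint : ∫ x in A, ‖G x‖ ^ 2 / (1 + ‖G x‖ ^ 2) ^ (3 / 2 : ℝ)
      = σ * ∫ r in Icc R (2 * R), r ^ (n - 1) * ψ r := by
    rw [← integral_indicator hAm]
    have e1 : ∫ x, A.indicator (fun x => ‖G x‖ ^ 2 / (1 + ‖G x‖ ^ 2) ^ (3 / 2 : ℝ)) x
        = ∫ x : EuclideanSpace ℝ (Fin n), (Ico R (2 * R)).indicator ψ ‖x‖ := by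
      refine integral_congr_ae ?_
      filter_upwards [hGp, Measure.ae_ne volume (0 : EuclideanSpace ℝ (Fin n))] with x hx hx0
      by_cases hxA : x ∈ A
      · rw [indicator_of_mem hxA, indicator_of_mem ((hAmem x).mp hxA), hx, norm_radial_smul hx0,
          rpow_three_halves]
      · rw [indicator_of_notMem hxA, indicator_of_notMem fun h => hxA ((hAmem x).mpr h)]
    rw [e1, integral_radial volume (F := (Ico R (2 * R)).indicator ψ) fun r hr =>
      indicator_of_notMem (fun h => absurd (hR0.trans_le h.1) (not_lt.mpr hr)) _, finrank_euclideanSpace_fin]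
    congr 1
    rw [integral_Icc_eq_integral_Ico, ← integral_indicator measurableSet_Ico]
    congr 1; ext r
    by_cases hr : r ∈ Ico R (2 * R)
    · rw [indicator_of_mem hr, indicator_of_mem hr]
    · rw [indicator_of_notMem hr, indicator_of_notMem hr, mul_zero]
  have hRp : 0 < R ^ (2 * s + 2) := Real.rpow_pos_of_pos hR0 _
  have hlow : σ * (c * R ^ (2 * s + 2))
      ≤ ∫ x in A, ‖G x‖ ^ 2 / (1 + ‖G x‖ ^ 2) ^ (3 / 2 : ℝ) := by
    rw [hint]
    exact mul_le_mul_of_nonneg_left (hgrow R hR) hσ.le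
  have hvol : volume.real A ≤ 2 ^ n * R ^ n * κ := by
    calc volume.real A ≤ volume.real (Metric.ball (0 : EuclideanSpace ℝ (Fin n)) (2 * R)) :=
          measureReal_mono sdiff_subset measure_ball_lt_top.ne
      _ = 2 ^ n * R ^ n * κ := by
          rw [← Measure.addHaar_real_closedBall_eq_addHaar_real_ball,
            Measure.addHaar_real_closedBall volume _ (by positivity), finrank_euclideanSpace_fin,
            mul_pow]
  -- Positivity comes from the lower bound itself: on a null annulus the integral would vanish.
  have hvol0 : 0 < volume.real A := by
    refine lt_of_le_of_ne measureReal_nonneg fun h => ?_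
    have hz : volume A = 0 := (measureReal_eq_zero_iff
      ((measure_mono sdiff_subset).trans_lt measure_ball_lt_top).ne).mp h.symm
    rw [setIntegral_measure_zero _ hz] at hlow
    have : 0 < σ * (c * R ^ (2 * s + 2)) := by positivity
    linarith
  rw [setAverage_eq, smul_eq_mul]
  have hexp : R ^ (-(n : ℝ) + 2 * s + 2) = R ^ (2 * s + 2) / R ^ n := by
    rw [show -(n : ℝ) + 2 * s + 2 = (2 * s + 2) - n by ring, Real.rpow_sub hR0, Real.rpow_natCast]
  calc σ * c / (2 ^ n * κ) * R ^ (-(n : ℝ) + 2 * s + 2)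
      = (2 ^ n * R ^ n * κ)⁻¹ * (σ * (c * R ^ (2 * s + 2))) := by
        rw [hexp]; field_simp
    _ ≤ (volume.real A)⁻¹ * (σ * (c * R ^ (2 * s + 2))) := by
        gcongr
    _ ≤ _ := mul_le_mul_of_nonneg_left hlow (inv_nonneg.mpr hvol0.le)

end Growth

end StableMeanCurvature
end

/-! ### The lower bound and its Liouville consequences. -/

theorem theorem1p7 (n : ℕ) (hn : 2 ≤ n) (f : ℝ → ℝ) (hf : ContDiff ℝ 1 f)
    (u : EuclideanSpace ℝ (Fin n) → ℝ)
    (G : EuclideanSpace ℝ (Fin n) → EuclideanSpace ℝ (Fin n))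
    (hu : StableMeanCurvature.MemSobolevLoc 3 u)
    (hG : StableMeanCurvature.IsWeakGradient u G)
    (hrad : StableMeanCurvature.IsRadial u)
    (hstable : StableMeanCurvature.IsStableSolution f u G) :
    (¬ StableMeanCurvature.IsConstant u →
      ∃ c : ℝ, 0 < c ∧ ∃ R₀ : ℝ, 2 < R₀ ∧ ∀ R : ℝ, R₀ ≤ R →
        c * R ^ (-(n : ℝ) + 2 * √((n : ℝ) - 1) + 2) ≤
          ⨍ x in Metric.ball (0 : EuclideanSpace ℝ (Fin n)) (2 * R) \ Metric.ball 0 R,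
            ‖G x‖ ^ 2 / (1 + ‖G x‖ ^ 2) ^ (3 / 2 : ℝ)) ∧
    ((n ≤ 6 ∨
      (7 ≤ n ∧ StableMeanCurvature.NormIsLittleO G (-(n : ℝ) / 2 + √((n : ℝ) - 1) + 1)) ∨
      (7 ≤ n ∧ StableMeanCurvature.InvNormIsLittleO G (-(n : ℝ) + 2 * √((n : ℝ) - 1) + 2))) →
      StableMeanCurvature.IsConstant u) := by
  have hmain := hstable.exists_average_lower_bound hn hf (k := 1) hu hG hrad
  refine ⟨hmain, fun hcases => ?_⟩
  by_contra hconst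
  obtain ⟨c, hc, R₀, hR₀, hlow⟩ := hmain hconst
  set e : ℝ := -(n : ℝ) + 2 * √((n : ℝ) - 1) + 2 with he
  have hmeas : ∀ R : ℝ, MeasurableSet
      (Metric.ball (0 : EuclideanSpace ℝ (Fin n)) (2 * R) \ Metric.ball 0 R) := fun R =>
    measurableSet_ball.diff measurableSet_ball
  have hfin : ∀ R : ℝ, volume
      (Metric.ball (0 : EuclideanSpace ℝ (Fin n)) (2 * R) \ Metric.ball 0 R) ≠ ⊤ := fun R =>
    ((measure_mono Set.sdiff_subset).trans_lt measure_ball_lt_top).ne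
  have hnonneg : ∀ x, 0 ≤ ‖G x‖ ^ 2 / (1 + ‖G x‖ ^ 2) ^ (3 / 2 : ℝ) := fun x => by positivity
  have hsub : (0 : ℝ) ≤ (n : ℝ) - 1 := by
    have : (2 : ℝ) ≤ n := by exact_mod_cast hn
    linarith
  -- an upper bound `M * R ^ e` with `M < c` on some annulus is impossible
  have hcontra : 7 ≤ n → ∀ M B : ℝ, 0 ≤ M → M < c → (∀ᵐ x, B < ‖x‖ →
      ‖G x‖ ^ 2 / (1 + ‖G x‖ ^ 2) ^ (3 / 2 : ℝ) ≤ M * ‖x‖ ^ e) → False := by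
    intro h7 M B hM hMc hae
    -- Squaring reduces this to n² - 8n + 8 ≥ 0, true for n ≥ 7. It lets ‖x‖ ^ e be bounded by R ^ e
    -- on the whole annulus.
    have he0 : e ≤ 0 := by
      have h7' : (7 : ℝ) ≤ n := by exact_mod_cast h7
      have : √((n : ℝ) - 1) ≤ ((n : ℝ) - 2) / 2 := by
        rw [Real.sqrt_le_left (by linarith)]
        nlinarith
      linarith
    set R := max R₀ (B + 1)
    have hRR₀ : R₀ ≤ R := le_max_left _ _
    have hRB : B + 1 ≤ R := le_max_right _ _
    have hR0 : 0 < R := by linarith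
    have hRe : 0 < R ^ e := Real.rpow_pos_of_pos hR0 _
    have h1 := hlow R hRR₀
    have h2 := StableMeanCurvature.setAverage_le_of_ae_le (hmeas R) (hfin R)
      (mul_nonneg hM hRe.le) hnonneg (by
        filter_upwards [hae] with x hx hxA
        have hxR : R ≤ ‖x‖ := by simpa using hxA.2
        exact (hx (by linarith)).trans (mul_le_mul_of_nonneg_left
          (Real.rpow_le_rpow_of_nonpos hR0 hxR he0) hM))
    have h3 := le_of_mul_le_mul_right (h1.trans h2) hRe
    linarith
  rcases hcases with h6 | ⟨h7, hO⟩ | ⟨h7, hO⟩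
  -- Here n² - 8n + 8 < 0 on [2, 6], so the lower bound exceeds 1, the supremum allowed for the
  -- average.
  · have he0 : 0 < e := by
      have h6' : (n : ℝ) ≤ 6 := by exact_mod_cast h6
      have h2' : (2 : ℝ) ≤ n := by exact_mod_cast hn
      have : ((n : ℝ) - 2) / 2 < √((n : ℝ) - 1) := by
        rw [Real.lt_sqrt (by linarith)]
        nlinarith
      linarith
    obtain ⟨R, hR, hR1⟩ := (((tendsto_rpow_atTop he0).const_mul_atTop hc).eventually_gt_atTop 1
      |>.and (Filter.eventually_ge_atTop R₀)).exists
    have h2 := StableMeanCurvature.setAverage_le_of_ae_le (hmeas R) (hfin R) zero_le_one hnonneg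
      (Filter.Eventually.of_forall fun x _ => by
        rw [StableMeanCurvature.rpow_three_halves]
        exact StableMeanCurvature.sq_div_sqrt_pow_le_one _)
    linarith [hlow R hR1]
  -- The exponent in the hypothesis is e/2, so squaring turns √(c/2) into the constant c/2 < c.
  · obtain ⟨B, hB⟩ := hO (√(c / 2)) (Real.sqrt_pos.mpr (by linarith))
    refine hcontra h7 (c / 2) (max B 0) (by linarith) (by linarith) ?_
    filter_upwards [hB] with x hx hxB
    have hx0 : 0 < ‖x‖ := (le_max_right _ _).trans_lt hxB
    rw [StableMeanCurvature.rpow_three_halves]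
    calc _ ≤ ‖G x‖ ^ 2 := StableMeanCurvature.sq_div_sqrt_pow_le_sq _
      _ ≤ (√(c / 2) * ‖x‖ ^ (-(n : ℝ) / 2 + √((n : ℝ) - 1) + 1)) ^ 2 :=
          pow_le_pow_left₀ (norm_nonneg _) (hx ((le_max_left _ _).trans_lt hxB)) 2
      _ = c / 2 * ‖x‖ ^ e := by
          rw [mul_pow, Real.sq_sqrt (by linarith), ← Real.rpow_mul_natCast hx0.le]
          congr 2
          push_cast
          ring
  · obtain ⟨B, hB⟩ := hO (c / 2) (by linarith)
    refine hcontra h7 (c / 2) B (by linarith) (by linarith) ?_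
    filter_upwards [hB] with x hx hxB
    obtain ⟨hG0, hGx⟩ := hx hxB
    rw [StableMeanCurvature.rpow_three_halves]
    exact (StableMeanCurvature.sq_div_sqrt_pow_le_inv (norm_pos_iff.mpr hG0)).trans hGx
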